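/- **Setting.** Let $\mathcal X\subset\mathbb R^d$ be compact, and let $H$ be a reproducing kernel Hilbert space of functions $\mathcal X\to\mathbb R$ with (measurable) positive definite kernel $K$ satisfying $K(x,x)\le 1$ for all $x\in\mathcal X$. Let $f^*\in H$ with $\|f^*\|\le D$, let $x_*\in\mathcal X$ be a maximizer of $f^*$, and let $R\ge 0$. In round $t=1,2,\dots$ the learner plays $X_t\in\mathcal X$ and observes $Y_t=f^*(X_t)+\varepsilon_t$. Let $\mathcal F_{t}=\sigma(X_1,Y_1,\dots,X_{t},Y_{t})$; the noise is conditionally $R$-sub-Gaussian: $\mathbb E[e^{\lambda\varepsilon_t}\mid X_t,\mathcal F_{t-1}]\le e^{\lambda^2R^2/2}$ almost surely for all $\lambda\in\mathbb R$. For a sequence of arms put $V_t=\sum_{s=1}^{t}K(\cdot,X_s)K(\cdot,X_s)^{\top}$ and $\overline V_t=I_H+V_t$ (operators on $H$; $\det\overline V_t$ is the determinant of this finite-rank perturbation of the identity), and let $$\gamma_T=\sup_{x_1,\dots,x_T\in\mathcal X}\tfrac12\log\det\Big(I_H+\sum_{s=1}^{T}K(\cdot,x_s)K(\cdot,x_s)^{\top}\Big)$$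 be the maximum information gain. Put $$\hat f_{t}=\overline V_{t}^{-1}\sum_{s=1}^{t}Y_sK(\cdot,X_s),\qquad g_{t}(x)=\Big(\sqrt{2R^2\log\big(2\sqrt{\det\overline V_{t}}\big)}+D\Big)\,\big\|\overline V_{t}^{-1/2}K(\cdot,x)\big\|.$$ **Simple-Gaussian.** In each round $t\ge 1$ draw $w_t\sim\mathcal N(0,1)$, where $w_1,w_2,\dots$ are independent and $w_t$ is independent of $\mathcal F_{t-1}$, and play $$X_t\in\arg\max_{x\in\mathcal X}\big(\hat f_{t-1}(x)+w_t\,g_{t-1}(x)\big).$$ **Theorem.** The expected regret $\mathcal R(T)=\sum_{t=1}^{T}\big(f^*(x_*)-\mathbb E[f^*(X_t)]\big)$ of Simple-Gaussian is $O\big(\sqrt{T\log(T)\,\gamma_T}\,(\sqrt{R^2\gamma_T}+D)\big)$. That is, there is an absolute constant $C>0$ (depending on none of $d,\mathcal X,H,K,f^*,R,D$, the noise, or $T$) such that for all such problems and every horizon $T\ge 2$, $$\mathcal R(T)\le C\,\sqrt{T\log(T)\,\gamma_T}\,\Big(\sqrt{R^2\gamma_T}+D\Big).$$ -/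

import Mathlib

open MeasureTheory ProbabilityTheory

noncomputable section

namespace KernelBandit

/-! ### Deterministic quantities attached to a reproducing kernel Hilbert space

`H` is a real reproducing kernel Hilbert space of functions `A → ℝ` (Mathlib's `RKHS`).
Rounds are indexed from `0`: the arm of round `s + 1` is `x s`, and a quantity with index `t`
is computed from the first `t` rounds, that is, from `x s` and `y s` with `s < t`. -/

section Deterministic

variable {A : Type*} (H : Type*) [NormedAddCommGroup H] [InnerProductSpace ℝ H]
  [CompleteSpace H] [RKHS ℝ H A ℝ]

/-- The element `K(·, x)` of `H`. -/
def feature (x : A) : H := RKHS.kerFun H x 1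

/-- The (scalar) reproducing kernel `K(x, y)` of `H`. -/
def K (x y : A) : ℝ := feature H y x

/-- `V_t = ∑_{s ≤ t} K(·, x_s) K(·, x_s)ᵀ`, an operator of finite rank on `H`. -/
def V (x : ℕ → A) (t : ℕ) : H →L[ℝ] H :=
  ∑ s ∈ Finset.range t, InnerProductSpace.rankOne ℝ (feature H (x s)) (feature H (x s))

/-- `I_H + V_t`. -/
def Vbar (x : ℕ → A) (t : ℕ) : H →L[ℝ] H := 1 + V H x t

/-- The inverse of `I_H + V_t` in the algebra of bounded operators. -/
def VbarInv (x : ℕ → A) (t : ℕ) : H →L[ℝ] H := Ring.inverse (Vbar H x t)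

variable {H} in
/-- The (Fredholm) determinant `det (I + F)` of a finite-rank perturbation of the identity:
the determinant of the restriction of `I + F` to the finite-dimensional invariant subspace
`range F`. On a finite-dimensional space it is the usual determinant of `I + F`; see
`detOneAdd_eq_det`. -/
def detOneAdd (F : H →L[ℝ] H) : ℝ :=
  LinearMap.det (LinearMap.id + F.toLinearMap.rangeRestrict ∘ₗ F.toLinearMap.range.subtype)

/-- In finite dimension, `detOneAdd F` is the determinant of `I + F`. -/
theorem detOneAdd_eq_det {E : Type*} [NormedAddCommGroup E] [InnerProductSpace ℝ E]
    [FiniteDimensional ℝ E] (F : E →L[ℝ] E) :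
    detOneAdd F = LinearMap.det (LinearMap.id + F.toLinearMap) := by
  classical
  let b := Module.finBasis ℝ E
  let c := Module.finBasis ℝ F.toLinearMap.range
  have hF : F.toLinearMap = F.toLinearMap.range.subtype ∘ₗ F.toLinearMap.rangeRestrict := rfl
  rw [detOneAdd, ← LinearMap.det_toMatrix c, ← LinearMap.det_toMatrix b, map_add, map_add]
  conv_rhs => rw [hF]
  rw [LinearMap.toMatrix_comp c b c, LinearMap.toMatrix_comp b c b, LinearMap.toMatrix_id,
    LinearMap.toMatrix_id, Matrix.det_one_add_mul_comm]

/-- `det (I_H + V_t)`. -/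
def detVbar (x : ℕ → A) (t : ℕ) : ℝ := detOneAdd (V H x t)

/-- The maximum information gain `γ_T`, with regularization parameter `1`.
Only the first `T` entries of the sequence `x` matter. -/
def infoGain (T : ℕ) : ℝ := ⨆ x : ℕ → A, (1 / 2) * Real.log (detVbar H x T)

/-- The regularized least squares estimate `f̂_t = (I_H + V_t)⁻¹ ∑_{s ≤ t} y_s K(·, x_s)`. -/
def fHat (x : ℕ → A) (y : ℕ → ℝ) (t : ℕ) : H :=
  VbarInv H x t (∑ s ∈ Finset.range t, y s • feature H (x s))

/-- `‖(I_H + V_t)^{-1/2} K(·, z)‖`, that is, `√⟨K(·, z), (I_H + V_t)⁻¹ K(·, z)⟩`;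
see `norm_sqrt_apply_feature`. -/
def width (x : ℕ → A) (t : ℕ) (z : A) : ℝ :=
  √(inner ℝ (feature H z) (VbarInv H x t (feature H z)))

/-- `width` is the norm of `S K(·, z)` for any self-adjoint square root `S` of
`(I_H + V_t)⁻¹`. -/
theorem norm_sqrt_apply_feature (x : ℕ → A) (t : ℕ) (z : A) (S : H →L[ℝ] H)
    (hS : IsSelfAdjoint S) (hS2 : S * S = VbarInv H x t) :
    ‖S (feature H z)‖ = width H x t z := by
  have h : inner ℝ (feature H z) (VbarInv H x t (feature H z)) = ‖S (feature H z)‖ ^ 2 := by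
    rw [← hS2, ← real_inner_self_eq_norm_sq]
    conv_rhs => rw [← ContinuousLinearMap.adjoint_inner_right, hS.adjoint_eq]
    rfl
  rw [width, h, Real.sqrt_sq (norm_nonneg _)]

/-- The exploration function
`g_t(z) = (√(2 R² log (2 √det(I_H + V_t))) + D) ‖(I_H + V_t)^{-1/2} K(·, z)‖`. -/
def g (R D : ℝ) (x : ℕ → A) (t : ℕ) (z : A) : ℝ :=
  (√(2 * R ^ 2 * Real.log (2 * √(detVbar H x t))) + D) * width H x t z

/-- The randomized estimate `f̃_{t+1} = f̂_t + w g_t`, a function on the arms. -/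
def fTilde (R D : ℝ) (x : ℕ → A) (y : ℕ → ℝ) (w : ℝ) (t : ℕ) (z : A) : ℝ :=
  fHat H x y t z + w * g H R D x t z

end Deterministic

/-! ### The bandit protocol and the algorithm -/

section Protocol

variable {A : Type*} [MeasurableSpace A] {Ω : Type*} [MeasurableSpace Ω]

/-- The reward `Y_t = f(X_t) + ε_t`. -/
def reward (f : A → ℝ) (X : ℕ → Ω → A) (ε : ℕ → Ω → ℝ) (t : ℕ) (ω : Ω) : ℝ :=
  f (X t ω) + ε t ω

/-- The σ-algebra generated by the arms and rewards of the first `t` rounds. -/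
abbrev history (X : ℕ → Ω → A) (Y : ℕ → Ω → ℝ) (t : ℕ) : MeasurableSpace Ω :=
  ⨆ s : ℕ, ⨆ _ : s < t,
    MeasurableSpace.comap (X s) inferInstance ⊔ MeasurableSpace.comap (Y s) inferInstance

/-- The noise of every round is `R`-sub-Gaussian (in particular of mean zero) conditionally on
the past history and on the arm played in that round. -/
def IsCondSubGaussianNoise (μ : Measure Ω) (R : ℝ) (f : A → ℝ) (X : ℕ → Ω → A)
    (ε : ℕ → Ω → ℝ) : Prop :=
  ∀ (t : ℕ) (l : ℝ), Integrable (fun ω => Real.exp (l * ε t ω)) μ ∧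
    ∀ᵐ ω ∂μ, (μ[fun ω' => Real.exp (l * ε t ω') |
      history X (reward f X ε) t ⊔ MeasurableSpace.comap (X t) inferInstance]) ω
        ≤ Real.exp (1 / 2 * l ^ 2 * R ^ 2)

/-- The arms `X`, the noise `ε` and the exploration variables `w` form a run of the Generic-GP
algorithm with exploration distributions `P` (chosen in advance), for the reward function `f`, with noise level `R`
and norm bound `D`. Ties in the `argmax` may be broken in any (measurable) way. -/
structure IsGenericGPRun (H : Type*) [NormedAddCommGroup H] [InnerProductSpace ℝ H]
    [CompleteSpace H] [RKHS ℝ H A ℝ] (μ : Measure Ω) (P : ℕ → Measure ℝ) (R D : ℝ) (f : H)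
    (X : ℕ → Ω → A) (ε w : ℕ → Ω → ℝ) : Prop where
  measurable_arm : ∀ t, Measurable (X t)
  measurable_noise : ∀ t, Measurable (ε t)
  measurable_exploration : ∀ t, Measurable (w t)
  noise : IsCondSubGaussianNoise μ R f X ε
  /-- `w_t` is drawn from `P t`, -/
  law_exploration : ∀ t, μ.map (w t) = P t
  /-- the exploration variables are independent of each other, -/
  indep_exploration : iIndepFun w μ
  /-- and `w_t` is independent of the past. -/
  indep_history : ∀ t,
    Indep (MeasurableSpace.comap (w t) inferInstance) (history X (reward f X ε) t) μ
  /-- The arm played maximizes the randomized estimate. -/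
  argmax : ∀ t ω z,
    fTilde H R D (fun s => X s ω) (fun s => reward f X ε s ω) (w t ω) t z ≤
      fTilde H R D (fun s => X s ω) (fun s => reward f X ε s ω) (w t ω) t (X t ω)

/-- A run of Simple-Gaussian: the exploration distribution is `N(0, 1)` in every round. -/
def IsSimpleGaussianRun (H : Type*) [NormedAddCommGroup H] [InnerProductSpace ℝ H]
    [CompleteSpace H] [RKHS ℝ H A ℝ] (μ : Measure Ω) (R D : ℝ) (f : H)
    (X : ℕ → Ω → A) (ε w : ℕ → Ω → ℝ) : Prop :=
  IsGenericGPRun H μ (fun _ => gaussianReal 0 1) R D f X ε w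

/-- The pseudo-regret `∑_{t ≤ T} (f(x_*) - E[f(X_t)])`. -/
def regret (μ : Measure Ω) (f : A → ℝ) (xStar : A) (X : ℕ → Ω → A) (T : ℕ) : ℝ :=
  ∑ t ∈ Finset.range T, (f xStar - ∫ ω, f (X t ω) ∂μ)

end Protocol

end KernelBandit

end

/-! The proof avoids a failure event: the confidence width is inflated by a random factor that
depends only on the past, and the regret is paid for by resampling.

Confidence. By Sherman–Morrison, the self-normalized noise `S_t` and `det(I + V_t)` obey scalar
recursions. A one-dimensional Gaussian mixture in each round shows that `exp(S_t / (2R²)) / √det(I +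
V_t)` is a nonnegative supermartingale started at 1. Ville's inequality then gives the tail `e^{-a}`
for the largest excess `U` of `S_t / (2R²)` over `log(2√det)` up to time `T`. With `u ≤ U` the
excess at time `t`, almost surely `|f - f̂_t| ≤ q g_t` for all `t` and all arms, where `q = √(1 + u
/ log 2)`.

One round. Fix the past and resample a pair `(w', X')` from its conditional law given the past, with
`w'` in `[q, q+1]`. This event has probability `p(q) > 0`. On it `f(x_*) ≤ f̂(X') + w' g(X')`, by
confidence and the choice of `X'`; the arm actually played has index at least `f̂(X') + w g(X')`.
Hence `f(x_*)` exceeds that index by at most `(q + 1 - w) g(X')`. Averaging over the event and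
integrating removes the mean-zero `w`, which is independent of the past, and bounds the regret of
the round by `E[((q+1)/p(q) + q) g(X)] + E[w g(X)]`. The upper end of the window is what makes the
bound linear in `g(X')` with a coefficient known from the past, apart from `w`.

Summation. The cost `(q+1)/p(q) + q` is at most `e^{23} e^{0.9U}`, and `E e^{0.9U} ≤ 10`. As `U`
does not depend on the round, the sum of the `g_t(X_t)` can be bounded on each path, by the
elliptical potential lemma. The terms `w_t g_t(X_t)` are handled by Cauchy–Schwarz. For `γ ≥ 1/2`
the constant `log 2` in `g` is absorbed by `γ`; for `γ ≤ 1/2` the kernel is of size at most `4γ/T`,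
and `f` is so small that any play suffices. -/

noncomputable section

namespace KernelBandit

/-! ### Rank-one updates of the regularized inverse. -/

section Operator

variable {A : Type*} (H : Type*) [NormedAddCommGroup H] [InnerProductSpace ℝ H]
  [CompleteSpace H] [RKHS ℝ H A ℝ]

variable {H} in
theorem inner_feature_left (x : A) (f : H) : inner ℝ (feature H x) f = f x := by
  simp [feature]

theorem V_succ (x : ℕ → A) (t : ℕ) : V H x (t + 1) =
    V H x t + InnerProductSpace.rankOne ℝ (feature H (x t)) (feature H (x t)) := by
  rw [V, Finset.sum_range_succ, V]

theorem isPositive_V (x : ℕ → A) (t : ℕ) : (V H x t).IsPositive := by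
  induction t with
  | zero => simp [V]
  | succ t ih =>
    rw [V_succ]
    exact ih.add (InnerProductSpace.isPositive_rankOne_self _)

theorem isPositive_Vbar (x : ℕ → A) (t : ℕ) : (Vbar H x t).IsPositive :=
  ContinuousLinearMap.isPositive_one.add (isPositive_V H x t)

theorem isUnit_Vbar (x : ℕ → A) (t : ℕ) : IsUnit (Vbar H x t) := by
  refine ContinuousLinearMap.isUnit_of_forall_le_norm_inner_map _ (c := 1) one_pos fun v => ?_
  have h := (isPositive_V H x t).inner_nonneg_left v
  have h2 : inner ℝ (Vbar H x t v) v = ‖v‖ ^ 2 + inner ℝ (V H x t v) v := by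
    simp [Vbar, inner_add_left]
  rw [h2, Real.norm_eq_abs]
  refine le_trans ?_ (le_abs_self _)
  simpa using h

theorem Vbar_VbarInv (x : ℕ → A) (t : ℕ) (v : H) : Vbar H x t (VbarInv H x t v) = v := by
  have := Ring.mul_inverse_cancel _ (isUnit_Vbar H x t)
  exact congrArg (fun F : H →L[ℝ] H => F v) this

theorem VbarInv_Vbar (x : ℕ → A) (t : ℕ) (v : H) : VbarInv H x t (Vbar H x t v) = v := by
  have := Ring.inverse_mul_cancel _ (isUnit_Vbar H x t)
  exact congrArg (fun F : H →L[ℝ] H => F v) this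

theorem VbarInv_symm (x : ℕ → A) (t : ℕ) (u v : H) :
    inner ℝ u (VbarInv H x t v) = inner ℝ (VbarInv H x t u) v := by
  conv_lhs => rw [← Vbar_VbarInv H x t u]
  rw [(isPositive_Vbar H x t).inner_left_eq_inner_right, Vbar_VbarInv]

theorem inner_VbarInv_self_nonneg (x : ℕ → A) (t : ℕ) (v : H) :
    0 ≤ inner ℝ v (VbarInv H x t v) := by
  conv_rhs => rw [← Vbar_VbarInv H x t v, VbarInv_Vbar]
  exact (isPositive_Vbar H x t).inner_nonneg_left _

/-- Cauchy–Schwarz for the form of the inverse: `r ↦ ⟨r u + v, (I + V)⁻¹ (r u + v)⟩` is a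
nonnegative quadratic, so its discriminant is at most 0. -/
theorem inner_VbarInv_sq_le (x : ℕ → A) (t : ℕ) (u v : H) :
    inner ℝ u (VbarInv H x t v) ^ 2 ≤
      inner ℝ u (VbarInv H x t u) * inner ℝ v (VbarInv H x t v) := by
  have h := discrim_le_zero (a := inner ℝ u (VbarInv H x t u))
    (b := 2 * inner ℝ u (VbarInv H x t v)) (c := inner ℝ v (VbarInv H x t v)) fun r => by
      have := inner_VbarInv_self_nonneg H x t (r • u + v)
      have h2 : inner ℝ v (VbarInv H x t u) = inner ℝ u (VbarInv H x t v) := by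
        rw [VbarInv_symm, real_inner_comm]
      simp only [map_add, map_smul, inner_add_left, inner_add_right, real_inner_smul_left,
        real_inner_smul_right, h2] at this
      linarith
  rw [discrim] at h
  nlinarith

theorem abs_inner_VbarInv_le (x : ℕ → A) (t : ℕ) (u v : H) :
    |inner ℝ u (VbarInv H x t v)| ≤
      √(inner ℝ u (VbarInv H x t u)) * √(inner ℝ v (VbarInv H x t v)) := by
  rw [← Real.sqrt_mul (inner_VbarInv_self_nonneg H x t u)]
  exact Real.abs_le_sqrt (inner_VbarInv_sq_le H x t u v)

/-- The posterior covariance `⟨K(·, z), (I_H + V_t)⁻¹ K(·, z')⟩`. -/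
def postCov (x : ℕ → A) (t : ℕ) (z z' : A) : ℝ :=
  inner ℝ (feature H z) (VbarInv H x t (feature H z'))

theorem inner_VbarInv_feature (x : ℕ → A) (t : ℕ) (z z' : A) :
    inner ℝ (feature H z) (VbarInv H x t (feature H z')) = postCov H x t z z' := rfl

theorem postCov_comm (x : ℕ → A) (t : ℕ) (z z' : A) :
    postCov H x t z z' = postCov H x t z' z := by
  rw [postCov, VbarInv_symm, real_inner_comm, postCov]

theorem postCov_self_nonneg (x : ℕ → A) (t : ℕ) (z : A) : 0 ≤ postCov H x t z z :=
  inner_VbarInv_self_nonneg H x t _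

theorem one_add_postCov_self_pos (x : ℕ → A) (t : ℕ) (z : A) : 0 < 1 + postCov H x t z z := by
  linarith [postCov_self_nonneg H x t z]

theorem width_eq (x : ℕ → A) (t : ℕ) (z : A) : width H x t z = √(postCov H x t z z) := rfl

/-- The Sherman–Morrison formula. -/
theorem VbarInv_succ (x : ℕ → A) (t : ℕ) (v : H) :
    VbarInv H x (t + 1) v = VbarInv H x t v -
      (inner ℝ (feature H (x t)) (VbarInv H x t v) / (1 + postCov H x t (x t) (x t))) •
        VbarInv H x t (feature H (x t)) := by
  have hs := (one_add_postCov_self_pos H x t (x t)).ne'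
  have key : ∀ u, Vbar H x (t + 1) u =
      Vbar H x t u + inner ℝ (feature H (x t)) u • feature H (x t) := fun u => by
    simp [Vbar, V_succ, add_assoc]
  rw [← VbarInv_Vbar H x (t + 1) (VbarInv H x t v - _)]
  congr 1
  rw [key, map_sub, map_smul, Vbar_VbarInv, Vbar_VbarInv, inner_sub_right, real_inner_smul_right,
    ← postCov]
  set s := postCov H x t (x t) (x t)
  set a : ℝ := inner ℝ (feature H (x t)) (VbarInv H x t v)
  have : a - a / (1 + s) * s = a / (1 + s) := by field_simp; ring
  rw [this]; abel

theorem VbarInv_zero (x : ℕ → A) : VbarInv H x 0 = 1 := by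
  simp [VbarInv, Vbar, V]

theorem postCov_zero (x : ℕ → A) (z z' : A) : postCov H x 0 z z' = K H z z' := by
  rw [postCov, VbarInv_zero, K, ← inner_feature_left]; rfl

/-- This and the later recursions express every quantity through kernel values. Measurability and
the supermartingale step are read off from them without a measurable structure on `H`. -/
theorem postCov_succ (x : ℕ → A) (t : ℕ) (z z' : A) :
    postCov H x (t + 1) z z' = postCov H x t z z' -
      postCov H x t z (x t) * postCov H x t (x t) z' / (1 + postCov H x t (x t) (x t)) := by
  rw [postCov, VbarInv_succ, inner_sub_right, real_inner_smul_right]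
  simp only [inner_VbarInv_feature]
  ring

theorem postCov_self_le (x : ℕ → A) (t : ℕ) (z : A) : postCov H x t z z ≤ K H z z := by
  induction t with
  | zero => rw [postCov_zero]
  | succ t ih =>
    rw [postCov_succ, postCov_comm H x t z (x t)]
    have := div_nonneg (mul_self_nonneg (postCov H x t (x t) z))
      (one_add_postCov_self_pos H x t (x t)).le
    linarith

theorem inner_VbarInv_self_le (x : ℕ → A) (t : ℕ) (v : H) :
    inner ℝ v (VbarInv H x t v) ≤ ‖v‖ ^ 2 := by
  induction t with
  | zero => simp [VbarInv_zero]
  | succ t ih =>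
    rw [VbarInv_succ, inner_sub_right, real_inner_smul_right, VbarInv_symm H x t v (feature _ _),
      real_inner_comm (feature H (x t))]
    have := div_nonneg (mul_self_nonneg (inner ℝ (feature H (x t)) (VbarInv H x t v)))
      (one_add_postCov_self_pos H x t (x t)).le
    rw [div_mul_eq_mul_div]
    linarith

/-! ### Regularized least squares -/

/-- `∑_{s < t} e_s K(·, x_s)`. -/
def featureSum (x : ℕ → A) (e : ℕ → ℝ) (t : ℕ) : H :=
  ∑ s ∈ Finset.range t, e s • feature H (x s)

theorem featureSum_succ (x : ℕ → A) (e : ℕ → ℝ) (t : ℕ) : featureSum H x e (t + 1) =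
    featureSum H x e t + e t • feature H (x t) := by
  rw [featureSum, Finset.sum_range_succ, featureSum]

theorem fHat_eq_inner (x : ℕ → A) (e : ℕ → ℝ) (t : ℕ) (z : A) : fHat H x e t z =
    inner ℝ (feature H z) (VbarInv H x t (featureSum H x e t)) := by
  rw [inner_feature_left]; rfl

theorem fHat_zero (x : ℕ → A) (e : ℕ → ℝ) (z : A) : fHat H x e 0 z = 0 := by
  simp [fHat_eq_inner, featureSum]

theorem fHat_succ (x : ℕ → A) (e : ℕ → ℝ) (t : ℕ) (z : A) : fHat H x e (t + 1) z =
    fHat H x e t z + postCov H x t z (x t) * (e t - fHat H x e t (x t)) /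
      (1 + postCov H x t (x t) (x t)) := by
  have hs := (one_add_postCov_self_pos H x t (x t)).ne'
  rw [fHat_eq_inner, featureSum_succ, VbarInv_succ]
  simp only [map_add, map_smul, inner_add_right, inner_sub_right, real_inner_smul_right,
    inner_VbarInv_feature, ← fHat_eq_inner]
  field_simp
  ring

/-- `‖∑_{s < t} e_s K(·, x_s)‖²` in the norm of `(I_H + V_t)⁻¹`. -/
def selfNorm (x : ℕ → A) (e : ℕ → ℝ) (t : ℕ) : ℝ :=
  inner ℝ (featureSum H x e t) (VbarInv H x t (featureSum H x e t))

theorem inner_VbarInv_featureSum (x : ℕ → A) (e : ℕ → ℝ) (t : ℕ) :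
    inner ℝ (featureSum H x e t) (VbarInv H x t (featureSum H x e t)) = selfNorm H x e t := rfl

theorem selfNorm_zero (x : ℕ → A) (e : ℕ → ℝ) : selfNorm H x e 0 = 0 := by
  simp [selfNorm, featureSum]

/-- The increment, divided by `2R²`, is the exponent produced by the Gaussian mixture in
`lintegral_exp_quadratic_le`, with `a` the noise estimate at the new arm and `s` its posterior
variance. -/
theorem selfNorm_succ (x : ℕ → A) (e : ℕ → ℝ) (t : ℕ) : selfNorm H x e (t + 1) =
    selfNorm H x e t + (2 * e t * fHat H x e t (x t) + e t ^ 2 * postCov H x t (x t) (x t)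
      - fHat H x e t (x t) ^ 2) / (1 + postCov H x t (x t) (x t)) := by
  have hs := (one_add_postCov_self_pos H x t (x t)).ne'
  have h1 : inner ℝ (featureSum H x e t) (VbarInv H x t (feature H (x t))) =
      fHat H x e t (x t) := by
    rw [VbarInv_symm, real_inner_comm, fHat_eq_inner]
  rw [selfNorm, featureSum_succ, VbarInv_succ]
  simp only [map_add, map_smul, inner_add_right, inner_sub_right, real_inner_smul_right,
    inner_add_left, real_inner_smul_left, inner_VbarInv_feature, ← fHat_eq_inner, h1,
    inner_VbarInv_featureSum]
  field_simp
  ring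

theorem featureSum_add (x : ℕ → A) (e e' : ℕ → ℝ) (t : ℕ) :
    featureSum H x (fun s => e s + e' s) t = featureSum H x e t + featureSum H x e' t := by
  simp [featureSum, add_smul, Finset.sum_add_distrib]

variable {H} in
theorem featureSum_eval (f : H) (x : ℕ → A) (t : ℕ) :
    featureSum H x (fun s => f (x s)) t = V H x t f := by
  simp [featureSum, V, inner_feature_left]

variable {H} in
-- The error splits as `(I + V)⁻¹ f` minus `(I + V)⁻¹ ∑ e_s K(·, x_s)`, evaluated at `z`.
-- Cauchy–Schwarz bounds both; the bias costs at most `‖f‖` because `(I + V)⁻¹ ≤ I`.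
theorem abs_sub_fHat_le (f : H) {D : ℝ} (hf : ‖f‖ ≤ D) (x : ℕ → A) (e : ℕ → ℝ) (t : ℕ) (z : A) :
    |f z - fHat H x (fun s => f (x s) + e s) t z| ≤
      (√(selfNorm H x e t) + D) * width H x t z := by
  have h1 : V H x t f = Vbar H x t f - f := by simp [Vbar]
  have h2 : f z - fHat H x (fun s => f (x s) + e s) t z =
      inner ℝ (feature H z) (VbarInv H x t f) -
        inner ℝ (feature H z) (VbarInv H x t (featureSum H x e t)) := by
    rw [fHat_eq_inner, featureSum_add, featureSum_eval, h1, map_add, map_sub, VbarInv_Vbar,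
      inner_add_right, inner_sub_right, inner_feature_left z f]
    ring
  have h3 : √(inner ℝ f (VbarInv H x t f)) ≤ D :=
    (Real.sqrt_le_sqrt (inner_VbarInv_self_le H x t f)).trans
      (by rwa [Real.sqrt_sq (norm_nonneg _)])
  rw [h2]
  refine (abs_sub _ _).trans ?_
  have h4 := abs_inner_VbarInv_le H x t (feature H z) f
  have h5 := abs_inner_VbarInv_le H x t (feature H z) (featureSum H x e t)
  have h6 : 0 ≤ width H x t z := Real.sqrt_nonneg _
  have h7 := mul_le_mul_of_nonneg_left h3 h6
  rw [width] at *
  rw [selfNorm]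
  nlinarith

end Operator

/-! ### The determinant under rank-one updates, and the elliptical potential. -/

section Determinant

/-- The Weinstein–Aronszajn identity for linear maps. -/
theorem det_id_add_comp_comm {E F : Type*} [AddCommGroup E] [Module ℝ E] [FiniteDimensional ℝ E]
    [AddCommGroup F] [Module ℝ F] [FiniteDimensional ℝ F] (f : E →ₗ[ℝ] F) (g : F →ₗ[ℝ] E) :
    LinearMap.det (LinearMap.id + g ∘ₗ f) = LinearMap.det (LinearMap.id + f ∘ₗ g) := by
  classical
  let b := Module.finBasis ℝ E
  let c := Module.finBasis ℝ F
  rw [← LinearMap.det_toMatrix c, ← LinearMap.det_toMatrix b, map_add, map_add,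
    LinearMap.toMatrix_comp c b c, LinearMap.toMatrix_comp b c b, LinearMap.toMatrix_id,
    LinearMap.toMatrix_id, Matrix.det_one_add_mul_comm]

theorem det_id_add_rankOne {E : Type*} [AddCommGroup E] [Module ℝ E] [FiniteDimensional ℝ E]
    (l : E →ₗ[ℝ] ℝ) (v : E) :
    LinearMap.det (LinearMap.id + LinearMap.toSpanSingleton ℝ E v ∘ₗ l) = 1 + l v := by
  rw [det_id_add_comp_comm, show LinearMap.id + l ∘ₗ LinearMap.toSpanSingleton ℝ E v =
    (1 + l v) • LinearMap.id from by ext; simp]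
  simp

variable {H : Type*} [NormedAddCommGroup H] [InnerProductSpace ℝ H]

/-- `detOneAdd F` may be computed on any finite-dimensional subspace containing `range F`. -/
theorem detOneAdd_eq_det_restrict (F : H →L[ℝ] H) (W : Submodule ℝ H) [FiniteDimensional ℝ W]
    (hW : ∀ v, F v ∈ W) : detOneAdd F =
      LinearMap.det (LinearMap.id + F.toLinearMap.restrict (p := W) (q := W) fun v _ => hW v) := by
  have hle : F.toLinearMap.range ≤ W := by rintro _ ⟨v, rfl⟩; exact hW v
  have : FiniteDimensional ℝ F.toLinearMap.range := Submodule.finiteDimensional_of_le hle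
  -- On `W` the operator factors through `range F`; swapping the two factors gives the operator that
  -- defines `detOneAdd`.
  have := det_id_add_comp_comm (F.toLinearMap.rangeRestrict ∘ₗ W.subtype)
    (Submodule.inclusion hle)
  exact this.symm

variable {A : Type*} (H) [CompleteSpace H] [RKHS ℝ H A ℝ]

theorem detVbar_zero (x : ℕ → A) : detVbar H x 0 = 1 := by
  have : V H x 0 = 0 := by simp [V]
  rw [detVbar, this, detOneAdd_eq_det_restrict 0 ⊥ (by simp)]
  exact LinearMap.det_eq_one_of_subsingleton _

theorem V_apply_mem_span (x : ℕ → A) (t T : ℕ) (h : t ≤ T) (v : H) :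
    V H x t v ∈ Submodule.span ℝ ((fun s => feature H (x s)) '' Set.Iio T) := by
  induction t with
  | zero => simp [V]
  | succ t ih =>
    rw [V_succ]
    refine Submodule.add_mem _ (ih (by omega)) (Submodule.smul_mem _ _ (Submodule.subset_span ?_))
    exact ⟨t, Set.mem_Iio.2 (by omega), rfl⟩

/-- With `φ = K(·, x_t)`, `I + V_{t+1} = (I + V_t)(I + ((I + V_t)⁻¹ φ) φᵀ)`. This holds on the span
`W` of the first `t + 1` features, which contains `(I + V_t)⁻¹ φ = φ - V_t (I + V_t)⁻¹ φ`. -/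
theorem detVbar_succ (x : ℕ → A) (t : ℕ) :
    detVbar H x (t + 1) = detVbar H x t * (1 + postCov H x t (x t) (x t)) := by
  set W : Submodule ℝ H := Submodule.span ℝ ((fun s => feature H (x s)) '' Set.Iio (t + 1))
  have : FiniteDimensional ℝ W :=
    FiniteDimensional.span_of_finite ℝ ((Set.finite_Iio (t + 1)).image _)
  have hφ : feature H (x t) ∈ W := Submodule.subset_span ⟨t, by simp, rfl⟩
  have h0 : ∀ v, V H x t v ∈ W := fun v => V_apply_mem_span H x t (t + 1) (by omega) v
  have h1 : ∀ v, V H x (t + 1) v ∈ W := fun v => V_apply_mem_span H x (t + 1) _ le_rfl v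
  have hJV : VbarInv H x t (feature H (x t)) + V H x t (VbarInv H x t (feature H (x t))) =
      feature H (x t) := Vbar_VbarInv H x t (feature H (x t))
  have hJ : VbarInv H x t (feature H (x t)) ∈ W := by
    rw [eq_sub_of_add_eq hJV]
    exact W.sub_mem hφ (h0 _)
  have h2 := det_id_add_rankOne ((innerSL ℝ (feature H (x t))).toLinearMap ∘ₗ W.subtype)
    (⟨_, hJ⟩ : W)
  rw [detVbar, detVbar, detOneAdd_eq_det_restrict _ W h0, detOneAdd_eq_det_restrict _ W h1]
  refine Eq.trans ?_ (congrArg₂ (· * ·) rfl h2)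
  rw [← LinearMap.det_comp]
  congr 1
  ext v
  have h3 : ((V H x (t + 1)) (v : H)) = V H x t v +
      (inner ℝ (feature H (x t)) (v : H) • VbarInv H x t (feature H (x t)) +
        inner ℝ (feature H (x t)) (v : H) • V H x t (VbarInv H x t (feature H (x t)))) := by
    rw [V_succ, ← smul_add, hJV]
    rfl
  simp [h3]
  abel

theorem one_le_detVbar (x : ℕ → A) (t : ℕ) : 1 ≤ detVbar H x t := by
  induction t with
  | zero => rw [detVbar_zero]
  | succ t ih =>
    rw [detVbar_succ]
    nlinarith [postCov_self_nonneg H x t (x t)]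

theorem detVbar_pos (x : ℕ → A) (t : ℕ) : 0 < detVbar H x t :=
  one_pos.trans_le (one_le_detVbar H x t)

theorem detVbar_mono (x : ℕ → A) : Monotone (detVbar H x) := by
  refine monotone_nat_of_le_succ fun t => ?_
  rw [detVbar_succ]
  nlinarith [postCov_self_nonneg H x t (x t), one_le_detVbar H x t]

/-! ### The information gain -/

/-- A crude bound, uniform in the arms, which makes the supremum defining `γ_T` finite. -/
theorem detVbar_le_two_pow (hK : ∀ z : A, K H z z ≤ 1) (x : ℕ → A) (t : ℕ) :
    detVbar H x t ≤ 2 ^ t := by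
  induction t with
  | zero => rw [detVbar_zero, pow_zero]
  | succ t ih =>
    rw [detVbar_succ, pow_succ]
    have h1 := postCov_self_le H x t (x t)
    have h2 := hK (x t)
    exact mul_le_mul ih (by linarith) (one_add_postCov_self_pos H x t (x t)).le (by positivity)

theorem log_detVbar_le (hK : ∀ z : A, K H z z ≤ 1) (x : ℕ → A) (T : ℕ) :
    Real.log (detVbar H x T) ≤ 2 * infoGain H T := by
  have hb : BddAbove (Set.range fun x : ℕ → A => (1 / 2) * Real.log (detVbar H x T)) := by
    refine ⟨(1 / 2) * Real.log (2 ^ T), ?_⟩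
    rintro _ ⟨x, rfl⟩
    have := Real.log_le_log (detVbar_pos H x T) (detVbar_le_two_pow H hK x T)
    simp only
    linarith
  have := le_ciSup hb x
  rw [infoGain]
  linarith

theorem infoGain_nonneg (T : ℕ) : 0 ≤ infoGain H T :=
  Real.iSup_nonneg fun x => mul_nonneg (by norm_num) (Real.log_nonneg (one_le_detVbar H x T))

/-- Playing one arm forever bounds `γ_T` from below by `K(z, z)`; this is what makes the kernel
small when `γ_T` is small. -/
theorem postCov_const (z : A) (t : ℕ) :
    postCov H (fun _ => z) t z z = K H z z / (1 + t * K H z z) ∧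
      detVbar H (fun _ => z) t = 1 + t * K H z z := by
  have hK : 0 ≤ K H z z := by
    have := postCov_self_nonneg H (fun _ => z) 0 z
    rwa [postCov_zero] at this
  induction t with
  | zero => simp [postCov_zero, detVbar_zero]
  | succ t ih =>
    have h1 : 1 + t * K H z z ≠ 0 := by positivity
    have h2 : 1 + (t + 1) * K H z z ≠ 0 := by positivity
    have h3 : 1 + t * K H z z + K H z z ≠ 0 := by positivity
    rw [postCov_succ, detVbar_succ, ih.1, ih.2]
    push_cast
    constructor
    · field_simp
      ring
    · field_simp
      ring

theorem log_one_add_mul_le_infoGain (hK : ∀ z : A, K H z z ≤ 1) (z : A) (T : ℕ) :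
    Real.log (1 + T * K H z z) ≤ 2 * infoGain H T := by
  rw [← (postCov_const H z T).2]
  exact log_detVbar_le H hK _ T

/-- The elliptical potential lemma. -/
theorem sum_postCov_le (hK : ∀ z : A, K H z z ≤ 1) (x : ℕ → A) (T : ℕ) :
    ∑ t ∈ Finset.range T, postCov H x t (x t) (x t) ≤ 2 * Real.log (detVbar H x T) := by
  induction T with
  | zero => simp [detVbar_zero]
  | succ T ih =>
    have h0 := postCov_self_nonneg H x T (x T)
    have h1 := (postCov_self_le H x T (x T)).trans (hK _)
    have h2 : 0 < 1 + postCov H x T (x T) (x T) := by linarith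
    rw [Finset.sum_range_succ, detVbar_succ, Real.log_mul (detVbar_pos H x T).ne' h2.ne']
    have h3 := Real.one_sub_inv_le_log_of_pos h2
    -- `s/2 ≤ s/(1+s)` because the posterior variance `s` lies in `[0, 1]`.
    have h4 : postCov H x T (x T) (x T) / 2 ≤ 1 - (1 + postCov H x T (x T) (x T))⁻¹ := by
      rw [← sub_nonneg]
      have : 1 - (1 + postCov H x T (x T) (x T))⁻¹ - postCov H x T (x T) (x T) / 2 =
          postCov H x T (x T) (x T) * (1 - postCov H x T (x T) (x T)) /
            (2 * (1 + postCov H x T (x T) (x T))) := by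
        field_simp; ring
      rw [this]
      exact div_nonneg (mul_nonneg h0 (by linarith)) (by linarith)
    linarith

end Determinant

/-! ### Measurability of the estimates along random arms. -/

section Measurability

variable {A : Type*} [MeasurableSpace A] {H : Type*} [NormedAddCommGroup H]
  [InnerProductSpace ℝ H] [CompleteSpace H] [RKHS ℝ H A ℝ]

/-- Elements of an RKHS with measurable kernel are measurable. -/
theorem measurable_coe (hK : Measurable fun p : A × A => K H p.1 p.2) (f : H) :
    Measurable (f : A → ℝ) := by
  have hspan : ∀ h ∈ Submodule.span ℝ {RKHS.kerFun H x v | (x : A) (v : ℝ)},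
      Measurable (h : A → ℝ) := by
    intro h hh
    induction hh using Submodule.span_induction with
    | mem h hh =>
      obtain ⟨x, v, rfl⟩ := hh
      have h1 : RKHS.kerFun H x v = v • feature H x := by
        rw [feature, ← map_smul, smul_eq_mul, mul_one]
      have h2 : Measurable (feature H x : A → ℝ) :=
        (hK.comp (measurable_prodMk_right : Measurable fun z : A => (z, x)) :)
      rw [h1, RKHS.coe_smul]
      exact h2.const_smul v
    | zero => rw [RKHS.coe_zero]; exact measurable_const
    | add f g _ _ hf hg => rw [RKHS.coe_add]; exact hf.add hg
    | smul c f _ hf => rw [RKHS.coe_smul]; exact hf.const_smul c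
  -- Kernel sections span a dense subspace, and norm convergence implies pointwise convergence, so
  -- `f` is a pointwise limit of measurable functions.
  have hf : f ∈ (Submodule.span ℝ {RKHS.kerFun H x v | (x : A) (v : ℝ)}).topologicalClosure := by
    rw [RKHS.kerFun_dense]; trivial
  obtain ⟨u, hu, hlim⟩ := mem_closure_iff_seq_limit.1 hf
  refine measurable_of_tendsto_metrizable (fun n => hspan _ (hu n)) ?_
  rw [tendsto_pi_nhds]
  exact fun x => ((RKHS.continuous_eval x).tendsto f).comp hlim

variable {Ω : Type*} [MeasurableSpace Ω] {X : ℕ → Ω → A} {e : ℕ → Ω → ℝ}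

/-- Joint measurability in the outcome and both arms is needed for the induction: the recursion
evaluates at the random arm `X t`. -/
theorem measurable_postCov_prod (hK : Measurable fun p : A × A => K H p.1 p.2) {t : ℕ}
    (hX : ∀ s < t, Measurable (X s)) :
    Measurable fun p : Ω × A × A => postCov H (fun s => X s p.1) t p.2.1 p.2.2 := by
  induction t with
  | zero => simp only [postCov_zero]; exact (hK.comp measurable_snd :)
  | succ t ih =>
    have h := ih fun s hs => hX s (by omega)
    have hXt := hX t (by omega)
    simp only [postCov_succ]
    have h1 : Measurable fun p : Ω × A × A => (p.1, p.2.1, X t p.1) := by fun_prop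
    have h2 : Measurable fun p : Ω × A × A => (p.1, X t p.1, p.2.2) := by fun_prop
    have h3 : Measurable fun p : Ω × A × A => (p.1, X t p.1, X t p.1) := by fun_prop
    have h4 : Measurable fun p : Ω × A × A =>
        postCov H (fun s => X s p.1) t p.2.1 (X t p.1) := (h.comp h1 :)
    have h5 : Measurable fun p : Ω × A × A =>
        postCov H (fun s => X s p.1) t (X t p.1) p.2.2 := (h.comp h2 :)
    have h6 : Measurable fun p : Ω × A × A =>
        postCov H (fun s => X s p.1) t (X t p.1) (X t p.1) := (h.comp h3 :)
    exact h.sub ((h4.mul h5).div (h6.const_add 1))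

theorem measurable_postCov {Ω' : Type*} [MeasurableSpace Ω']
    (hK : Measurable fun p : A × A => K H p.1 p.2) {t : ℕ} (hX : ∀ s < t, Measurable (X s))
    {ψ : Ω' → Ω} {z z' : Ω' → A} (hψ : Measurable ψ) (hz : Measurable z) (hz' : Measurable z') :
    Measurable fun p => postCov H (fun s => X s (ψ p)) t (z p) (z' p) :=
  ((measurable_postCov_prod hK hX).comp (hψ.prodMk (hz.prodMk hz')) :)

theorem measurable_width {Ω' : Type*} [MeasurableSpace Ω']
    (hK : Measurable fun p : A × A => K H p.1 p.2) {t : ℕ} (hX : ∀ s < t, Measurable (X s))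
    {ψ : Ω' → Ω} {z : Ω' → A} (hψ : Measurable ψ) (hz : Measurable z) :
    Measurable fun p => width H (fun s => X s (ψ p)) t (z p) :=
  (measurable_postCov hK hX hψ hz hz).sqrt

theorem measurable_fHat_prod (hK : Measurable fun p : A × A => K H p.1 p.2) {t : ℕ}
    (hX : ∀ s < t, Measurable (X s)) (he : ∀ s < t, Measurable (e s)) :
    Measurable fun p : Ω × A => fHat H (fun s => X s p.1) (fun s => e s p.1) t p.2 := by
  induction t with
  | zero => simp only [fHat_zero]; exact measurable_const
  | succ t ih =>
    have h := ih (fun s hs => hX s (by omega)) fun s hs => he s (by omega)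
    have hXt := hX t (by omega)
    have het := he t (by omega)
    have hX' : ∀ s < t, Measurable (X s) := fun s hs => hX s (by omega)
    have h0 : Measurable fun p : Ω × A => X t p.1 := by fun_prop
    have h1 : Measurable fun p : Ω × A => (p.1, X t p.1) := by fun_prop
    have h2 : Measurable fun p : Ω × A =>
        fHat H (fun s => X s p.1) (fun s => e s p.1) t (X t p.1) := (h.comp h1 :)
    have h3 : Measurable fun p : Ω × A =>
        postCov H (fun s => X s p.1) t p.2 (X t p.1) :=
      measurable_postCov hK hX' measurable_fst measurable_snd h0
    have h4 : Measurable fun p : Ω × A =>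
        postCov H (fun s => X s p.1) t (X t p.1) (X t p.1) :=
      measurable_postCov hK hX' measurable_fst h0 h0
    simp only [fHat_succ]
    exact h.add ((h3.mul ((het.comp measurable_fst).sub h2)).div (h4.const_add 1))

theorem measurable_fHat {Ω' : Type*} [MeasurableSpace Ω']
    (hK : Measurable fun p : A × A => K H p.1 p.2) {t : ℕ}
    (hX : ∀ s < t, Measurable (X s)) (he : ∀ s < t, Measurable (e s))
    {ψ : Ω' → Ω} {z : Ω' → A} (hψ : Measurable ψ) (hz : Measurable z) :
    Measurable fun p => fHat H (fun s => X s (ψ p)) (fun s => e s (ψ p)) t (z p) :=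
  ((measurable_fHat_prod hK hX he).comp (hψ.prodMk hz) :)

theorem measurable_detVbar (hK : Measurable fun p : A × A => K H p.1 p.2) {t : ℕ}
    (hX : ∀ s < t, Measurable (X s)) : Measurable fun p => detVbar H (fun s => X s p) t := by
  induction t with
  | zero => simp only [detVbar_zero]; exact measurable_const
  | succ t ih =>
    have hX' : ∀ s < t, Measurable (X s) := fun s hs => hX s (by omega)
    have hXt := hX t (by omega)
    simp only [detVbar_succ]
    exact (ih hX').mul (measurable_const.add (measurable_postCov hK hX' measurable_id hXt hXt))

theorem measurable_selfNorm (hK : Measurable fun p : A × A => K H p.1 p.2) {t : ℕ}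
    (hX : ∀ s < t, Measurable (X s)) (he : ∀ s < t, Measurable (e s)) :
    Measurable fun p => selfNorm H (fun s => X s p) (fun s => e s p) t := by
  induction t with
  | zero => simp only [selfNorm_zero]; exact measurable_const
  | succ t ih =>
    have hX' : ∀ s < t, Measurable (X s) := fun s hs => hX s (by omega)
    have he' : ∀ s < t, Measurable (e s) := fun s hs => he s (by omega)
    have hXt := hX t (by omega)
    have het := he t (by omega)
    have h1 := measurable_fHat hK hX' he' measurable_id hXt
    have h2 := measurable_postCov hK hX' measurable_id hXt hXt
    simp only [selfNorm_succ]
    exact (ih hX' he').add ((((measurable_const.mul het).mul h1).add ((het.pow_const 2).mul h2)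
      |>.sub (h1.pow_const 2)).div (measurable_const.add h2))

theorem measurable_g {Ω' : Type*} [MeasurableSpace Ω']
    (hK : Measurable fun p : A × A => K H p.1 p.2) (R D : ℝ) {t : ℕ}
    (hX : ∀ s < t, Measurable (X s)) {ψ : Ω' → Ω} {z : Ω' → A}
    (hψ : Measurable ψ) (hz : Measurable z) :
    Measurable fun p => g H R D (fun s => X s (ψ p)) t (z p) := by
  have h := (measurable_detVbar hK hX).comp hψ
  exact ((measurable_const.mul (measurable_const.mul h.sqrt).log).sqrt.add measurable_const).mul
    (measurable_width hK hX hψ hz)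

end Measurability

/-! ### Method of mixtures and Ville's inequality. -/

section Mixture

open Real in
/-- Gaussian mixture of the exponential weights `exp (l y - l² / 2)`. -/
theorem lintegral_exp_mul_gaussianPDF (y b s : ℝ) (hs : 0 ≤ s) :
    ∫⁻ z, ENNReal.ofReal (exp ((b + √s * z) * y)) *
      ENNReal.ofReal (exp (-(b + √s * z) ^ 2 / 2) * gaussianPDFReal 0 1 z) =
    ENNReal.ofReal (exp ((2 * y * b + y ^ 2 * s - b ^ 2) / (2 * (1 + s))) * (√(1 + s))⁻¹) := by
  set v : NNReal := ⟨(1 + s)⁻¹, inv_nonneg.2 (by linarith)⟩ with hv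
  have hs1 : 0 < 1 + s := by linarith
  have hvc : (v : ℝ) = (1 + s)⁻¹ := rfl
  have hv0 : v ≠ 0 := NNReal.coe_ne_zero.1 (by rw [hvc]; positivity)
  set c := exp ((2 * y * b + y ^ 2 * s - b ^ 2) / (2 * (1 + s))) * (√(1 + s))⁻¹ with hc
  have hc0 : 0 ≤ c := by positivity
  -- Completing the square in `z`: the integrand is a constant times a Gaussian density of variance
  -- `1/(1+s)`.
  have key : ∀ z, exp ((b + √s * z) * y) * (exp (-(b + √s * z) ^ 2 / 2) * gaussianPDFReal 0 1 z) =
      c * gaussianPDFReal (√s * (y - b) / (1 + s)) v z := by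
    intro z
    have h1 : (√(2 * π * (v : ℝ)))⁻¹ = (√(2 * π))⁻¹ * √(1 + s) := by
      rw [hvc, sqrt_mul (by positivity), sqrt_inv, mul_inv, inv_inv]
    have hq : √s * √s = s := mul_self_sqrt hs
    rw [gaussianPDFReal, gaussianPDFReal, h1, hc]
    have h2 : (√(1 + s))⁻¹ * √(1 + s) = 1 := inv_mul_cancel₀ (by positivity)
    have h3 : exp ((b + √s * z) * y) * (exp (-(b + √s * z) ^ 2 / 2) *
        exp (-(z - 0) ^ 2 / (2 * ((1 : NNReal) : ℝ)))) =
        exp ((2 * y * b + y ^ 2 * s - b ^ 2) / (2 * (1 + s))) *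
          exp (-(z - √s * (y - b) / (1 + s)) ^ 2 / (2 * (v : ℝ))) := by
      rw [← exp_add, ← exp_add, ← exp_add, hvc]
      congr 1
      rw [NNReal.coe_one]
      field_simp
      have hq2 : √s ^ 2 = s := sq_sqrt hs
      ring_nf
      simp only [hq2]
      ring
    calc _ = (√(2 * π))⁻¹ * (exp ((b + √s * z) * y) * (exp (-(b + √s * z) ^ 2 / 2) *
        exp (-(z - 0) ^ 2 / (2 * ((1 : NNReal) : ℝ))))) := by
          rw [NNReal.coe_one, mul_one]; ring
      _ = _ := by
          rw [h3]
          linear_combination (-(√(2 * π))⁻¹ *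
            (exp ((2 * y * b + y ^ 2 * s - b ^ 2) / (2 * (1 + s))) *
              exp (-(z - √s * (y - b) / (1 + s)) ^ 2 / (2 * (v : ℝ))))) * h2
  simp_rw [← ENNReal.ofReal_mul (exp_nonneg _), key, ENNReal.ofReal_mul hc0]
  rw [lintegral_const_mul _ (measurable_gaussianPDFReal _ _).ennreal_ofReal]
  have := lintegral_gaussianPDFReal_eq_one (√s * (y - b) / (1 + s)) hv0
  rw [this, mul_one]

/-- The integrand is `√(1+s)` times the average of `exp(l y/R - l²/2)` over `l ~ N(a/R, s)`. After
Tonelli, the sub-Gaussian bound at `l/R` cancels `exp(-l²/2)` exactly. -/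
theorem lintegral_exp_quadratic_le {ν : Measure ℝ} [SFinite ν] {R : ℝ} (hR : 0 < R)
    (hν : ∀ l : ℝ, ∫⁻ y, ENNReal.ofReal (Real.exp (l * y)) ∂ν ≤
      ENNReal.ofReal (Real.exp (1 / 2 * l ^ 2 * R ^ 2))) (a : ℝ) {s : ℝ} (hs : 0 ≤ s) :
    ∫⁻ y, ENNReal.ofReal (Real.exp ((2 * y * a + y ^ 2 * s - a ^ 2) / (2 * R ^ 2 * (1 + s)))) ∂ν
      ≤ ENNReal.ofReal √(1 + s) := by
  have hs1 : 0 < 1 + s := by linarith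
  have h1 : ∀ y, ENNReal.ofReal
      (Real.exp ((2 * y * a + y ^ 2 * s - a ^ 2) / (2 * R ^ 2 * (1 + s)))) =
      ENNReal.ofReal √(1 + s) * ∫⁻ z, ENNReal.ofReal (Real.exp ((a / R + √s * z) * (y / R))) *
        ENNReal.ofReal (Real.exp (-(a / R + √s * z) ^ 2 / 2) * gaussianPDFReal 0 1 z) := by
    intro y
    rw [lintegral_exp_mul_gaussianPDF _ _ _ hs, ← ENNReal.ofReal_mul (Real.sqrt_nonneg _)]
    congr 1
    rw [mul_left_comm, mul_inv_cancel₀ (by positivity), mul_one]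
    congr 1
    field_simp
  simp_rw [h1]
  rw [lintegral_const_mul' _ _ ENNReal.ofReal_ne_top, lintegral_lintegral_swap (by fun_prop)]
  refine mul_le_of_le_one_right' ?_
  have h2 := lintegral_gaussianPDFReal_eq_one 0 (one_ne_zero : (1 : NNReal) ≠ 0)
  rw [← h2]
  refine lintegral_mono fun z => ?_
  rw [lintegral_mul_const _ (by fun_prop)]
  have h3 := hν ((a / R + √s * z) / R)
  have h4 : ∀ y, (a / R + √s * z) * (y / R) = (a / R + √s * z) / R * y := fun y => by ring
  simp_rw [h4]
  refine (mul_le_mul_left h3 _).trans ?_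
  rw [← ENNReal.ofReal_mul (Real.exp_nonneg _), ← mul_assoc, ← Real.exp_add]
  have h5 : 1 / 2 * ((a / R + √s * z) / R) ^ 2 * R ^ 2 + -(a / R + √s * z) ^ 2 / 2 = 0 := by
    field_simp; ring
  rw [h5, Real.exp_zero, one_mul]

/-- A bound on the moment generating function at rational points extends to all reals. -/
theorem lintegral_exp_le_of_rat {ν : Measure ℝ} {R : ℝ}
    (hν : ∀ l : ℚ, ∫⁻ y, ENNReal.ofReal (Real.exp (l * y)) ∂ν ≤
      ENNReal.ofReal (Real.exp (1 / 2 * (l : ℝ) ^ 2 * R ^ 2))) (l : ℝ) :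
    ∫⁻ y, ENNReal.ofReal (Real.exp (l * y)) ∂ν ≤
      ENNReal.ofReal (Real.exp (1 / 2 * l ^ 2 * R ^ 2)) := by
  obtain ⟨u, hu, hlim⟩ := mem_closure_iff_seq_limit.1 (Rat.denseRange_cast (𝕜 := ℝ) l)
  choose r hr using hu
  have h1 : ∀ y : ℝ, Filter.Tendsto (fun n => ENNReal.ofReal (Real.exp (u n * y))) Filter.atTop
      (nhds (ENNReal.ofReal (Real.exp (l * y)))) := fun y =>
    ENNReal.tendsto_ofReal ((Real.continuous_exp.tendsto _).comp (hlim.mul_const y))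
  have h2 : Filter.Tendsto (fun n => ENNReal.ofReal (Real.exp (1 / 2 * (u n) ^ 2 * R ^ 2)))
      Filter.atTop (nhds (ENNReal.ofReal (Real.exp (1 / 2 * l ^ 2 * R ^ 2)))) :=
    ENNReal.tendsto_ofReal ((Real.continuous_exp.tendsto _).comp
      (((hlim.pow 2).const_mul _).mul_const _))
  calc ∫⁻ y, ENNReal.ofReal (Real.exp (l * y)) ∂ν
      = ∫⁻ y, Filter.liminf (fun n => ENNReal.ofReal (Real.exp (u n * y))) Filter.atTop ∂ν :=
        lintegral_congr fun y => (h1 y).liminf_eq.symm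
    _ ≤ Filter.liminf (fun n => ∫⁻ y, ENNReal.ofReal (Real.exp (u n * y)) ∂ν) Filter.atTop :=
        lintegral_liminf_le fun n => by fun_prop
    _ ≤ Filter.liminf (fun n => ENNReal.ofReal (Real.exp (1 / 2 * (u n) ^ 2 * R ^ 2)))
        Filter.atTop := Filter.liminf_le_liminf (Filter.Eventually.of_forall fun n => by
          have := hν (r n); rwa [hr n] at this)
    _ = _ := h2.liminf_eq

variable {Ω β : Type*} [MeasurableSpace Ω] [MeasurableSpace β] {μ : Measure Ω}

/-- Under the conditional law of `ε` given `Z`, the values `a(Z)`, `s(Z)` and `M(Z)` are constants,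
so the unconditional bound applies fibrewise. -/
theorem lintegral_mul_exp_quadratic_le [IsProbabilityMeasure μ] {Z : Ω → β} (hZ : Measurable Z) {ε : Ω → ℝ}
    (hε : Measurable ε) {R : ℝ} (hR : 0 < R)
    (hsub : ∀ l : ℝ, Integrable (fun ω => Real.exp (l * ε ω)) μ ∧
      ∀ᵐ ω ∂μ, (μ[fun ω' => Real.exp (l * ε ω') | MeasurableSpace.comap Z inferInstance]) ω ≤
        Real.exp (1 / 2 * l ^ 2 * R ^ 2))
    {a s : β → ℝ} (ha : Measurable a) (hs : Measurable s) (hs0 : ∀ b, 0 ≤ s b)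
    {M : β → ENNReal} (hM : Measurable M) :
    ∫⁻ ω, M (Z ω) * ENNReal.ofReal (Real.exp ((2 * ε ω * a (Z ω) + ε ω ^ 2 * s (Z ω)
      - a (Z ω) ^ 2) / (2 * R ^ 2 * (1 + s (Z ω))))) ∂μ ≤
    ∫⁻ ω, M (Z ω) * ENNReal.ofReal √(1 + s (Z ω)) ∂μ := by
  set κ := condDistrib ε Z μ
  have hκ : (μ.map Z) ⊗ₘ κ = μ.map fun ω => (Z ω, ε ω) := compProd_map_condDistrib hε.aemeasurable
  -- The exceptional null set depends on `l`; restricting to rational `l` leaves a countable union,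
  -- and `lintegral_exp_le_of_rat` recovers the other values.
  have hae : ∀ᵐ ω ∂μ, ∀ l : ℚ, ∫⁻ y, ENNReal.ofReal (Real.exp (l * y)) ∂(κ (Z ω)) ≤
      ENNReal.ofReal (Real.exp (1 / 2 * (l : ℝ) ^ 2 * R ^ 2)) := by
    rw [ae_all_iff]
    intro l
    have hm : StronglyMeasurable fun y : ℝ => Real.exp (l * y) := by
      refine Continuous.stronglyMeasurable ?_; fun_prop
    have h1 := condExp_ae_eq_integral_condDistrib hZ hε.aemeasurable hm (hsub l).1
    have h2 : ∀ᵐ ω ∂μ, Integrable (fun y : ℝ => Real.exp (l * y)) (κ (Z ω)) := by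
      refine Integrable.condDistrib_ae (f := fun p : β × ℝ => Real.exp (l * p.2)) hZ.aemeasurable
        hε.aemeasurable ?_
      rw [integrable_map_measure (by fun_prop) (by fun_prop)]
      exact (hsub l).1
    filter_upwards [h1, h2, (hsub l).2] with ω h1 h2 h3
    rw [← ofReal_integral_eq_lintegral_ofReal h2 (Filter.Eventually.of_forall fun _ =>
      (Real.exp_pos _).le), ← h1]
    exact ENNReal.ofReal_le_ofReal h3
  have hmeas : Measurable fun p : β × ℝ => M p.1 * ENNReal.ofReal (Real.exp ((2 * p.2 * a p.1 +
      p.2 ^ 2 * s p.1 - a p.1 ^ 2) / (2 * R ^ 2 * (1 + s p.1)))) := by fun_prop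
  calc _ = ∫⁻ p, M p.1 * ENNReal.ofReal (Real.exp ((2 * p.2 * a p.1 +
        p.2 ^ 2 * s p.1 - a p.1 ^ 2) / (2 * R ^ 2 * (1 + s p.1))))
          ∂(μ.map fun ω => (Z ω, ε ω)) := (lintegral_map hmeas (hZ.prodMk hε)).symm
    _ = ∫⁻ ω, ∫⁻ y, M (Z ω) * ENNReal.ofReal (Real.exp ((2 * y * a (Z ω) +
        y ^ 2 * s (Z ω) - a (Z ω) ^ 2) / (2 * R ^ 2 * (1 + s (Z ω))))) ∂(κ (Z ω)) ∂μ := by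
          rw [← hκ, Measure.lintegral_compProd hmeas,
            lintegral_map hmeas.lintegral_kernel_prod_right' hZ]
    _ ≤ _ := by
      refine lintegral_mono_ae ?_
      filter_upwards [hae] with ω hω
      rw [lintegral_const_mul _ (by fun_prop)]
      exact mul_le_mul_right (lintegral_exp_quadratic_le hR (lintegral_exp_le_of_rat hω) _
        (hs0 _)) _

/-- Ville's maximal inequality on a finite horizon. -/
theorem mul_meas_exists_le_le {F : ℕ → MeasurableSpace Ω} (hF : ∀ t, F t ≤ ‹MeasurableSpace Ω›)
    (hmono : Monotone F) {L : ℕ → Ω → ENNReal} (hL : ∀ t, Measurable[F t] (L t))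
    (h0 : ∫⁻ ω, L 0 ω ∂μ ≤ 1)
    (hstep : ∀ t, ∀ s, MeasurableSet[F t] s → ∫⁻ ω in s, L (t + 1) ω ∂μ ≤ ∫⁻ ω in s, L t ω ∂μ)
    (T : ℕ) (x : ENNReal) : x * μ {ω | ∃ t ≤ T, x ≤ L t ω} ≤ 1 := by
  set S : ℕ → Set Ω := fun T => {ω | ∃ t ≤ T, x ≤ L t ω} with hS
  have hSm : ∀ t, MeasurableSet[F t] (S t) := by
    intro t
    have : S t = ⋃ r ∈ Finset.range (t + 1), {ω | x ≤ L r ω} := by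
      ext ω; simp [hS]
    rw [this]
    refine @Finset.measurableSet_biUnion _ _ (F t) _ _ fun r hr => ?_
    refine hmono (Nat.lt_succ_iff.1 (Finset.mem_range.1 hr)) _ ?_
    exact @measurableSet_le _ _ _ _ _ (F r) _ _ _ _ _ measurable_const (hL r)
  -- Invariant of the stopped process: the mass of `L` where the level `x` has not been reached,
  -- plus `x` times the probability that it has, never exceeds 1.
  have key : ∀ t, ∫⁻ ω in (S t)ᶜ, L t ω ∂μ + x * μ (S t) ≤ 1 := by
    intro t
    induction t with
    | zero =>
      have h1 : x * μ (S 0) ≤ ∫⁻ ω in S 0, L 0 ω ∂μ := by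
        rw [← setLIntegral_const]
        refine setLIntegral_mono' (hF 0 _ (hSm 0)) fun ω hω => ?_
        obtain ⟨t, ht, h⟩ := hω
        rwa [Nat.le_zero.1 ht] at h
      rw [← lintegral_add_compl (L 0) (hF 0 _ (hSm 0)), add_comm] at h0
      exact (add_le_add le_rfl h1).trans h0
    | succ t ih =>
      have hsub : S t ⊆ S (t + 1) := fun ω ⟨r, hr, h⟩ => ⟨r, hr.trans (Nat.le_succ t), h⟩
      have hm := hF _ _ (hSm t)
      have hm' := hF _ _ (hSm (t + 1))
      have h1 : μ (S (t + 1)) = μ (S t) + μ ((S t)ᶜ ∩ S (t + 1)) := by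
        rw [← measure_inter_add_sdiff (S (t + 1)) hm, Set.inter_eq_self_of_subset_right hsub,
          Set.sdiff_eq, Set.inter_comm]
      have h2 : x * μ ((S t)ᶜ ∩ S (t + 1)) ≤ ∫⁻ ω in (S t)ᶜ ∩ S (t + 1), L (t + 1) ω ∂μ := by
        rw [← setLIntegral_const]
        refine setLIntegral_mono' (hm.compl.inter hm') fun ω ⟨hω1, r, hr, h⟩ => ?_
        rcases Nat.lt_or_ge r (t + 1) with hlt | hge
        · exact absurd ⟨r, Nat.lt_succ_iff.1 hlt, h⟩ hω1
        · rwa [le_antisymm hr hge] at h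
      have h3 : ∫⁻ ω in (S t)ᶜ, L (t + 1) ω ∂μ =
          ∫⁻ ω in (S t)ᶜ ∩ S (t + 1), L (t + 1) ω ∂μ + ∫⁻ ω in (S (t + 1))ᶜ, L (t + 1) ω ∂μ := by
        rw [← lintegral_inter_add_sdiff (L (t + 1)) (S t)ᶜ hm', Set.sdiff_eq,
          Set.inter_eq_self_of_subset_right (Set.compl_subset_compl.2 hsub)]
      calc _ ≤ ∫⁻ ω in (S t)ᶜ ∩ S (t + 1), L (t + 1) ω ∂μ +
            ∫⁻ ω in (S (t + 1))ᶜ, L (t + 1) ω ∂μ + x * μ (S t) := by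
              rw [h1, mul_add, add_comm (x * μ (S t)), ← add_assoc,
                add_comm (∫⁻ ω in (S (t + 1))ᶜ, L (t + 1) ω ∂μ)]
              exact add_le_add (add_le_add h2 le_rfl) le_rfl
        _ ≤ _ := by
          rw [← h3]
          exact (add_le_add (hstep t _ (@MeasurableSet.compl _ _ (F t) (hSm t))) le_rfl).trans ih
  exact le_trans le_add_self (key T)

end Mixture

/-! ### The self-normalized supermartingale of the noise. -/

section Concentration

variable {A : Type*} [MeasurableSpace A] {Ω : Type*}

theorem history_mono (X : ℕ → Ω → A) (Y : ℕ → Ω → ℝ) : Monotone (history X Y) := by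
  intro t t' h
  refine iSup_le fun s => iSup_le fun hs => ?_
  exact le_iSup₂_of_le s (hs.trans_le h) le_rfl

theorem measurable_arm_history (X : ℕ → Ω → A) (Y : ℕ → Ω → ℝ) {s t : ℕ} (h : s < t) :
    Measurable[history X Y t] (X s) :=
  Measurable.of_comap_le (le_iSup₂_of_le s h le_sup_left)

theorem measurable_reward_history (X : ℕ → Ω → A) (Y : ℕ → Ω → ℝ) {s t : ℕ} (h : s < t) :
    Measurable[history X Y t] (Y s) :=
  Measurable.of_comap_le (le_iSup₂_of_le s h le_sup_right)

theorem measurable_noise_history {f : A → ℝ} (hf : Measurable f) (X : ℕ → Ω → A)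
    (ε : ℕ → Ω → ℝ) {s t : ℕ} (h : s < t) : Measurable[history X (reward f X ε) t] (ε s) := by
  have h1 : ε s = fun ω => reward f X ε s ω - f (X s ω) := by
    ext ω; simp [reward]
  rw [h1]
  exact Measurable.sub (m := history X (reward f X ε) t) (measurable_reward_history X _ h)
    (hf.comp (measurable_arm_history X _ h))

variable [m0 : MeasurableSpace Ω]

theorem history_le {X : ℕ → Ω → A} {Y : ℕ → Ω → ℝ} (hX : ∀ t, Measurable (X t))
    (hY : ∀ t, Measurable (Y t)) (t : ℕ) : history X Y t ≤ m0 :=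
  iSup_le fun s => iSup_le fun _ => sup_le (hX s).comap_le (hY s).comap_le

variable {H : Type*} [NormedAddCommGroup H] [InnerProductSpace ℝ H] [CompleteSpace H]
  [RKHS ℝ H A ℝ] {μ : Measure Ω} {X : ℕ → Ω → A} {ε : ℕ → Ω → ℝ}

variable (H) in
/-- The self-normalized exponential supermartingale of the noise. -/
def expSelfNorm (R : ℝ) (X : ℕ → Ω → A) (ε : ℕ → Ω → ℝ) (t : ℕ) (ω : Ω) : ENNReal :=
  ENNReal.ofReal (Real.exp (selfNorm H (fun s => X s ω) (fun s => ε s ω) t / (2 * R ^ 2)) /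
    √(detVbar H (fun s => X s ω) t))

theorem measurable_expSelfNorm (hK : Measurable fun p : A × A => K H p.1 p.2) (R : ℝ) {t : ℕ}
    (hX : ∀ s < t, Measurable (X s)) (hε : ∀ s < t, Measurable (ε s)) :
    Measurable (expSelfNorm H R X ε t) :=
  (((measurable_selfNorm hK hX hε).div_const _).exp.div
    (measurable_detVbar hK hX).sqrt).ennreal_ofReal

theorem setLIntegral_expSelfNorm_succ_le [IsProbabilityMeasure μ]
    (hK : Measurable fun p : A × A => K H p.1 p.2)
    (hX : ∀ t, Measurable (X t)) (hε : ∀ t, Measurable (ε t)) {R : ℝ} (hR : 0 < R) (f : H)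
    (hnoise : IsCondSubGaussianNoise μ R f X ε) (t : ℕ) (S : Set Ω)
    (hS : MeasurableSet[history X (reward f X ε) t] S) :
    ∫⁻ ω in S, expSelfNorm H R X ε (t + 1) ω ∂μ ≤ ∫⁻ ω in S, expSelfNorm H R X ε t ω ∂μ := by
  have hf := measurable_coe hK f
  set Y := reward f X ε
  have hY : ∀ t, Measurable (Y t) := fun t => (hf.comp (hX t)).add (hε t)
  have hFle := history_le hX hY t
  -- The conditioning variable is the identity map into `Ω` with the σ-algebra of the past and the
  -- current arm; its comap is that σ-algebra.
  have hid : @Measurable Ω Ω m0 (history X Y t ⊔ MeasurableSpace.comap (X t) inferInstance) id :=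
    measurable_id'' (sup_le hFle (hX t).comap_le)
  set G : MeasurableSpace Ω := history X Y t ⊔ MeasurableSpace.comap (X t) inferInstance with hG
  have hFG : history X Y t ≤ G := le_sup_left
  have hXs : ∀ s < t, Measurable[G] (X s) := fun s hs =>
    (measurable_arm_history X Y hs).mono hFG le_rfl
  have hεs : ∀ s < t, Measurable[G] (ε s) := fun s hs =>
    (measurable_noise_history hf X ε hs).mono hFG le_rfl
  have hXt : Measurable[G] (X t) := Measurable.of_comap_le le_sup_right
  have ha := @measurable_fHat _ _ _ _ _ _ _ _ G _ _ _ G hK t hXs hεs id (X t)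
    (@measurable_id _ G) hXt
  have hs := @measurable_postCov _ _ _ _ _ _ _ _ G _ _ G hK t hXs id (X t) (X t)
    (@measurable_id _ G) hXt hXt
  have hM := @measurable_expSelfNorm _ _ _ G _ _ _ _ _ _ _ hK R t hXs hεs
  set a : Ω → ℝ := fun ω => fHat H (fun s => X s ω) (fun s => ε s ω) t (X t ω)
  set v : Ω → ℝ := fun ω => postCov H (fun s => X s ω) t (X t ω) (X t ω) with hv
  have hv0 : ∀ ω, 0 ≤ v ω := fun ω => postCov_self_nonneg H _ t _
  have hS' := hFG _ hS
  -- The weight includes `1/√(1+v)`, the growth of `1/√det` in this round; it cancels the factor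
  -- `√(1+v)` of the mixture bound.
  have hM2 : Measurable[G] fun ω => S.indicator (expSelfNorm H R X ε t) ω *
      ENNReal.ofReal (√(1 + v ω))⁻¹ :=
    Measurable.mul (hM.indicator hS')
      (Measurable.ennreal_ofReal (Measurable.inv (Measurable.sqrt (hs.const_add 1))))
  have main := @lintegral_mul_exp_quadratic_le Ω Ω m0 G μ _ id hid
    (ε t) (hε t) R hR (by
      intro l
      rw [MeasurableSpace.comap_id]
      exact hnoise t l) a v ha hs hv0 _ hM2
  rw [← lintegral_indicator (hFle _ hS), ← lintegral_indicator
    (hFle _ hS)]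
  refine le_trans (le_of_eq ?_) (main.trans (le_of_eq ?_))
  · refine lintegral_congr fun ω => ?_
    by_cases hω : ω ∈ S
    · simp only [Set.indicator_of_mem hω, id]
      simp only [expSelfNorm]
      have hd := detVbar_pos H (fun s => X s ω) t
      have h1 := hv0 ω
      rw [← ENNReal.ofReal_mul (by positivity), ← ENNReal.ofReal_mul (by positivity)]
      congr 1
      rw [selfNorm_succ, detVbar_succ, Real.sqrt_mul hd.le, add_div, Real.exp_add, div_div]
      have hva : postCov H (fun s => X s ω) t (X t ω) (X t ω) = v ω := rfl
      have haa : fHat H (fun s => X s ω) (fun s => ε s ω) t (X t ω) = a ω := rfl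
      rw [hva, haa, mul_comm (1 + v ω) (2 * R ^ 2)]
      field_simp
    · simp only [Set.indicator_of_notMem hω, id, zero_mul]
  · refine lintegral_congr fun ω => ?_
    have h1 := hv0 ω
    simp only [id]
    rw [mul_assoc, ← ENNReal.ofReal_mul (by positivity), inv_mul_cancel₀ (by positivity),
      ENNReal.ofReal_one, mul_one]

theorem mul_meas_exists_le_expSelfNorm_le [IsProbabilityMeasure μ]
    (hK : Measurable fun p : A × A => K H p.1 p.2)
    (hX : ∀ t, Measurable (X t)) (hε : ∀ t, Measurable (ε t)) {R : ℝ} (hR : 0 < R) (f : H)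
    (hnoise : IsCondSubGaussianNoise μ R f X ε) (T : ℕ) (x : ENNReal) :
    x * μ {ω | ∃ t ≤ T, x ≤ expSelfNorm H R X ε t ω} ≤ 1 := by
  have hf := measurable_coe hK f
  have hY : ∀ t, Measurable (reward f X ε t) := fun t => (hf.comp (hX t)).add (hε t)
  refine mul_meas_exists_le_le (history_le hX hY) (history_mono X _)
    (fun t => @measurable_expSelfNorm _ _ _ (history X (reward f X ε) t) _ _ _ _ _ _ _ hK R t
      (fun s hs => measurable_arm_history X _ hs)
      (fun s hs => measurable_noise_history hf X ε hs)) ?_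
    (setLIntegral_expSelfNorm_succ_le hK hX hε hR f hnoise) T x
  simp [expSelfNorm, selfNorm_zero, detVbar_zero]

/-- For `R = 0` the expectation of `e^ε + e^{-ε}` is at most 2, while pointwise the sum is at least
2 with equality only at `ε = 0`. -/
theorem noise_ae_eq_zero [IsProbabilityMeasure μ] (f : A → ℝ) (hX : ∀ t, Measurable (X t))
    (hf : Measurable f) (hε : ∀ t, Measurable (ε t))
    (hnoise : IsCondSubGaussianNoise μ 0 f X ε) (t : ℕ) : ∀ᵐ ω ∂μ, ε t ω = 0 := by
  have hY : ∀ t, Measurable (reward f X ε t) := fun t => (hf.comp (hX t)).add (hε t)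
  have hle : history X (reward f X ε) t ⊔ MeasurableSpace.comap (X t) inferInstance ≤ m0 :=
    sup_le (history_le hX hY t) (hX t).comap_le
  have h1 : ∀ l : ℝ, ∫ ω, Real.exp (l * ε t ω) ∂μ ≤ 1 := by
    intro l
    rw [← integral_condExp hle]
    refine (integral_mono_ae integrable_condExp (integrable_const 1) ?_).trans (by simp)
    filter_upwards [(hnoise t l).2] with ω hω
    simpa using hω
  have hi := ((hnoise t 1).1.add (hnoise t (-1)).1).sub (integrable_const (2 : ℝ))
  have h0 : 0 ≤ fun ω => Real.exp (1 * ε t ω) + Real.exp (-1 * ε t ω) - 2 := by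
    intro ω
    have := Real.one_le_cosh (ε t ω)
    rw [Real.cosh_eq] at this
    simp only [Pi.zero_apply, one_mul, neg_mul]
    linarith
  have h2 : ∫ ω, (Real.exp (1 * ε t ω) + Real.exp (-1 * ε t ω) - 2) ∂μ = 0 := by
    refine le_antisymm ?_ (integral_nonneg h0)
    have h3 := integral_sub ((hnoise t 1).1.add (hnoise t (-1)).1) (integrable_const (2 : ℝ))
    have h4 := integral_add (hnoise t 1).1 (hnoise t (-1)).1
    simp only [Pi.add_apply] at h3 h4
    rw [h3, h4]
    have := h1 1
    have := h1 (-1)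
    simp only [integral_const, probReal_univ, smul_eq_mul]
    linarith
  filter_upwards [(integral_eq_zero_iff_of_nonneg h0 hi).1 h2] with ω hω
  by_contra hne
  have := Real.one_lt_cosh.2 hne
  rw [Real.cosh_eq] at this
  simp only [Pi.zero_apply, one_mul, neg_mul] at hω
  linarith

end Concentration

/-! ### Random inflation of the confidence width. -/

section Confidence

/-- Layer cake: `1 + ∫₀^∞ 0.9 e^{0.9t} e^{-t} dt = 10`. The rate must be below 1, and above the
`0.62 / log 2 ≈ 0.894` needed in `resamplingCost_inflation_le`. -/
theorem lintegral_exp_le_of_tail {Ω : Type*} [MeasurableSpace Ω] {μ : Measure Ω}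
    [IsProbabilityMeasure μ] {U : Ω → ℝ} (hU : Measurable U) (hU0 : ∀ ω, 0 ≤ U ω)
    (htail : ∀ a > 0, μ {ω | a ≤ U ω} ≤ ENNReal.ofReal (Real.exp (-a))) :
    ∫⁻ ω, ENNReal.ofReal (Real.exp (9 / 10 * U ω)) ∂μ ≤ 10 := by
  have hder : ∀ x : ℝ, HasDerivAt (fun x => Real.exp (9 / 10 * x))
      (9 / 10 * Real.exp (9 / 10 * x)) x := fun x => by
    have := ((hasDerivAt_id x).const_mul (9 / 10 : ℝ)).exp
    simpa [mul_comm] using this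
  have hprim : ∀ x : ℝ, ∫ t in (0 : ℝ)..x, 9 / 10 * Real.exp (9 / 10 * t) =
      Real.exp (9 / 10 * x) - 1 := fun x => by
    rw [intervalIntegral.integral_eq_sub_of_hasDerivAt (fun t _ => hder t)
      (Continuous.intervalIntegrable (by fun_prop) _ _)]
    simp
  have hlayer := lintegral_comp_eq_lintegral_meas_le_mul μ (f := U)
    (g := fun t => 9 / 10 * Real.exp (9 / 10 * t)) (Filter.Eventually.of_forall hU0)
    hU.aemeasurable (fun t _ => Continuous.intervalIntegrable (by fun_prop) _ _)
    (Filter.Eventually.of_forall fun t => by positivity)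
  simp only [hprim] at hlayer
  have h1 : ∀ ω, ENNReal.ofReal (Real.exp (9 / 10 * U ω)) =
      ENNReal.ofReal (Real.exp (9 / 10 * U ω) - 1) + 1 := fun ω => by
    have : 1 ≤ Real.exp (9 / 10 * U ω) := Real.one_le_exp (by have := hU0 ω; positivity)
    rw [← ENNReal.ofReal_one, ← ENNReal.ofReal_add (by linarith) zero_le_one, sub_add_cancel]
  have h2 : ∫⁻ t in Set.Ioi (0 : ℝ), μ {ω | t ≤ U ω} *
      ENNReal.ofReal (9 / 10 * Real.exp (9 / 10 * t)) ≤ 9 := by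
    have h3 : ∫ t in Set.Ioi (0 : ℝ), 9 / 10 * Real.exp (-(1 / 10) * t) = 9 := by
      rw [integral_const_mul, integral_exp_mul_Ioi (by norm_num)]
      norm_num
    have h4 : IntegrableOn (fun t : ℝ => 9 / 10 * Real.exp (-(1 / 10) * t)) (Set.Ioi 0) :=
      (integrableOn_exp_mul_Ioi (by norm_num) 0).const_mul _
    calc _ ≤ ∫⁻ t in Set.Ioi (0 : ℝ), ENNReal.ofReal (9 / 10 * Real.exp (-(1 / 10) * t)) := by
          refine setLIntegral_mono' measurableSet_Ioi fun t ht => ?_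
          refine (mul_le_mul_left (htail t ht) _).trans (le_of_eq ?_)
          rw [← ENNReal.ofReal_mul (Real.exp_nonneg _), mul_left_comm, ← Real.exp_add]
          congr 3
          ring
      _ = ENNReal.ofReal 9 := by
          rw [← ofReal_integral_eq_lintegral_ofReal h4
            (Filter.Eventually.of_forall fun t => by positivity), h3]
      _ = 9 := by norm_num
  simp_rw [h1]
  rw [lintegral_add_right _ measurable_const, hlayer, lintegral_const, measure_univ]
  calc _ ≤ (9 : ENNReal) + 1 * 1 := by gcongr
    _ = 10 := by norm_num

variable {A : Type*} (H : Type*) [NormedAddCommGroup H] [InnerProductSpace ℝ H]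
  [CompleteSpace H] [RKHS ℝ H A ℝ]

/-- The normalized amount by which the self-normalized noise exceeds the bound that holds with probability `1 / 2`. -/
def excess (R : ℝ) (x : ℕ → A) (e : ℕ → ℝ) (t : ℕ) : ℝ :=
  max 0 (selfNorm H x e t / (2 * R ^ 2) - Real.log (2 * √(detVbar H x t)))

theorem excess_nonneg (R : ℝ) (x : ℕ → A) (e : ℕ → ℝ) (t : ℕ) : 0 ≤ excess H R x e t :=
  le_max_left _ _

/-- The factor by which the confidence width has to be inflated. -/
def inflation (u : ℝ) : ℝ := √(1 + u / Real.log 2)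

theorem one_le_inflation {u : ℝ} (hu : 0 ≤ u) : 1 ≤ inflation u := by
  rw [inflation, Real.one_le_sqrt]
  have := div_nonneg hu (Real.log_nonneg one_le_two)
  linarith

theorem inflation_sq {u : ℝ} (hu : 0 ≤ u) : inflation u ^ 2 = 1 + u / Real.log 2 := by
  have := div_nonneg hu (Real.log_nonneg one_le_two)
  rw [inflation, Real.sq_sqrt (by linarith)]

theorem log_two_le_log_two_mul_sqrt (x : ℕ → A) (t : ℕ) :
    Real.log 2 ≤ Real.log (2 * √(detVbar H x t)) := by
  have := Real.one_le_sqrt.2 (one_le_detVbar H x t)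
  exact Real.log_le_log two_pos (by linarith)

/-- The factor 2 inside the logarithm gives `l = log(2√det) ≥ log 2`, so an additive excess becomes
multiplicative: `l + u ≤ (1 + u / log 2) l`. -/
theorem sqrt_selfNorm_le {R : ℝ} (x : ℕ → A) (e : ℕ → ℝ) (t : ℕ)
    (hR : 0 < R ∨ selfNorm H x e t = 0) : √(selfNorm H x e t) ≤
      inflation (excess H R x e t) * √(2 * R ^ 2 * Real.log (2 * √(detVbar H x t))) := by
  rcases hR with hR | h0
  · have hu := excess_nonneg H R x e t
    have h2 := Real.log_pos one_lt_two
    have hl := log_two_le_log_two_mul_sqrt H x t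
    set l := Real.log (2 * √(detVbar H x t)) with hl_def
    rw [inflation, ← Real.sqrt_mul (by positivity)]
    refine Real.sqrt_le_sqrt ?_
    have h3 : selfNorm H x e t / (2 * R ^ 2) - l ≤ excess H R x e t := le_max_right _ _
    have h4 : selfNorm H x e t ≤ (l + excess H R x e t) * (2 * R ^ 2) := by
      rw [← div_le_iff₀ (by positivity)]; linarith
    have h5 : excess H R x e t ≤ excess H R x e t / Real.log 2 * l := by
      rw [div_mul_eq_mul_div, le_div_iff₀ h2]
      exact mul_le_mul_of_nonneg_left hl hu
    refine h4.trans ?_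
    have := mul_le_mul_of_nonneg_right h5 (by positivity : 0 ≤ 2 * R ^ 2)
    linarith
  · rw [h0, Real.sqrt_zero]
    exact mul_nonneg (Real.sqrt_nonneg _) (Real.sqrt_nonneg _)

variable {H} in
theorem abs_sub_fHat_le_inflation_mul_g {R D : ℝ} (f : H) (hf : ‖f‖ ≤ D) (x : ℕ → A)
    (e : ℕ → ℝ) (t : ℕ) (hR : 0 < R ∨ selfNorm H x e t = 0) (z : A) :
    |f z - fHat H x (fun s => f (x s) + e s) t z| ≤
      inflation (excess H R x e t) * g H R D x t z := by
  refine (abs_sub_fHat_le f hf x e t z).trans ?_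
  rw [g, ← mul_assoc]
  refine mul_le_mul_of_nonneg_right ?_ (Real.sqrt_nonneg _)
  have hD : 0 ≤ D := (norm_nonneg f).trans hf
  have h1 := one_le_inflation (excess_nonneg H R x e t)
  have h2 := sqrt_selfNorm_le H x e t hR
  nlinarith

variable {Ω : Type*}

/-- The largest excess up to time `T`. -/
def maxExcess (R : ℝ) (X : ℕ → Ω → A) (ε : ℕ → Ω → ℝ) (T : ℕ) (ω : Ω) : ℝ :=
  (Finset.range (T + 1)).sup' Finset.nonempty_range_add_one
    fun t => excess H R (fun s => X s ω) (fun s => ε s ω) t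

theorem excess_le_maxExcess (R : ℝ) (X : ℕ → Ω → A) (ε : ℕ → Ω → ℝ) {t T : ℕ} (h : t ≤ T)
    (ω : Ω) : excess H R (fun s => X s ω) (fun s => ε s ω) t ≤ maxExcess H R X ε T ω :=
  Finset.le_sup' (fun t => excess H R (fun s => X s ω) (fun s => ε s ω) t)
    (Finset.mem_range.2 (Nat.lt_succ_of_le h))

theorem maxExcess_nonneg (R : ℝ) (X : ℕ → Ω → A) (ε : ℕ → Ω → ℝ) (T : ℕ) (ω : Ω) :
    0 ≤ maxExcess H R X ε T ω :=
  (excess_nonneg H R _ _ 0).trans (excess_le_maxExcess H R X ε (Nat.zero_le T) ω)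

variable [MeasurableSpace A] [MeasurableSpace Ω] {μ : Measure Ω} {X : ℕ → Ω → A} {ε : ℕ → Ω → ℝ}
variable {H}

theorem measurable_excess (hK : Measurable fun p : A × A => K H p.1 p.2) (R : ℝ) {t : ℕ}
    (hX : ∀ s < t, Measurable (X s)) (hε : ∀ s < t, Measurable (ε s)) :
    Measurable fun ω => excess H R (fun s => X s ω) (fun s => ε s ω) t :=
  measurable_const.max (((measurable_selfNorm hK hX hε).div_const _).sub
    ((measurable_detVbar hK hX).sqrt.const_mul 2).log)

theorem measurable_maxExcess (hK : Measurable fun p : A × A => K H p.1 p.2) (R : ℝ) (T : ℕ)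
    (hX : ∀ s, Measurable (X s)) (hε : ∀ s, Measurable (ε s)) :
    Measurable (maxExcess H R X ε T) := by
  have := Finset.measurable_sup' (Finset.nonempty_range_add_one (n := T))
    (f := fun t ω => excess H R (fun s => X s ω) (fun s => ε s ω) t)
    fun t _ => measurable_excess hK R (fun s _ => hX s) (fun s _ => hε s)
  convert this using 1
  ext ω
  rw [maxExcess, Finset.sup'_apply]

/-- An excess of at least `a > 0` forces the supermartingale above `2e^a`, hence above `e^a`, and
Ville's inequality applies. -/
theorem meas_le_maxExcess_le [IsProbabilityMeasure μ]
    (hK : Measurable fun p : A × A => K H p.1 p.2)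
    (hX : ∀ t, Measurable (X t)) (hε : ∀ t, Measurable (ε t)) {R : ℝ} (hR : 0 ≤ R) (f : H)
    (hnoise : IsCondSubGaussianNoise μ R f X ε) (T : ℕ) (a : ℝ) (ha : 0 < a) :
    μ {ω | a ≤ maxExcess H R X ε T ω} ≤ ENNReal.ofReal (Real.exp (-a)) := by
  have hset : {ω | a ≤ maxExcess H R X ε T ω} ⊆
      {ω | ∃ t ≤ T, a ≤ excess H R (fun s => X s ω) (fun s => ε s ω) t} := by
    intro ω (hω : a ≤ maxExcess H R X ε T ω)
    rw [maxExcess, Finset.le_sup'_iff] at hω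
    obtain ⟨t, ht, h⟩ := hω
    exact ⟨t, Nat.lt_succ_iff.1 (Finset.mem_range.1 ht), h⟩
  rcases hR.eq_or_lt with rfl | hR
  · refine (measure_mono hset).trans ?_
    -- For `R = 0` division by zero gives 0, so the excess is `max 0 (-log(2√det)) = 0`.
    have : {ω | ∃ t ≤ T, a ≤ excess H 0 (fun s => X s ω) (fun s => ε s ω) t} = ∅ := by
      ext ω
      simp only [Set.mem_ofPred_eq, Set.mem_empty_iff_false, iff_false]
      rintro ⟨t, -, h⟩
      have h1 := (Real.log_pos one_lt_two).trans_le
        (log_two_le_log_two_mul_sqrt H (fun s => X s ω) t)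
      have h2 : excess H 0 (fun s => X s ω) (fun s => ε s ω) t = 0 := by
        rw [excess]
        refine max_eq_left ?_
        simp only [ne_eq, OfNat.ofNat_ne_zero, not_false_eq_true, zero_pow, mul_zero, div_zero]
        linarith
      linarith
    rw [this, measure_empty]
    exact zero_le
  · have hset2 : {ω | a ≤ maxExcess H R X ε T ω} ⊆
        {ω | ∃ t ≤ T, ENNReal.ofReal (Real.exp a) ≤ expSelfNorm H R X ε t ω} := by
      refine hset.trans ?_
      rintro ω ⟨t, ht, h⟩
      refine ⟨t, ht, ENNReal.ofReal_le_ofReal ?_⟩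
      have hd := Real.sqrt_pos.2 (detVbar_pos H (fun s => X s ω) t)
      have h1 : a ≤ selfNorm H (fun s => X s ω) (fun s => ε s ω) t / (2 * R ^ 2) -
          Real.log (2 * √(detVbar H (fun s => X s ω) t)) :=
        (le_max_iff.1 h).resolve_left (not_le.2 ha)
      rw [Real.log_mul two_ne_zero hd.ne'] at h1
      have h2 := Real.log_pos one_lt_two
      rw [le_div_iff₀ hd]
      nth_rewrite 1 [← Real.exp_log hd]
      rw [← Real.exp_add]
      exact Real.exp_le_exp.2 (by linarith)
    have h1 := mul_meas_exists_le_expSelfNorm_le hK hX hε hR f hnoise T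
      (ENNReal.ofReal (Real.exp a))
    have h2 : ENNReal.ofReal (Real.exp (-a)) = (ENNReal.ofReal (Real.exp a))⁻¹ := by
      rw [Real.exp_neg, ENNReal.ofReal_inv_of_pos (Real.exp_pos a)]
    rw [h2]
    refine (measure_mono hset2).trans ?_
    rw [ENNReal.le_inv_iff_mul_le, mul_comm]
    exact h1

theorem lintegral_exp_maxExcess_le [IsProbabilityMeasure μ]
    (hK : Measurable fun p : A × A => K H p.1 p.2)
    (hX : ∀ t, Measurable (X t)) (hε : ∀ t, Measurable (ε t)) {R : ℝ} (hR : 0 ≤ R) (f : H)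
    (hnoise : IsCondSubGaussianNoise μ R f X ε) (T : ℕ) :
    ∫⁻ ω, ENNReal.ofReal (Real.exp (9 / 10 * maxExcess H R X ε T ω)) ∂μ ≤ 10 :=
  lintegral_exp_le_of_tail (measurable_maxExcess hK R T hX hε) (maxExcess_nonneg H R X ε T)
    fun a ha => meas_le_maxExcess_le hK hX hε hR f hnoise T a ha

theorem ae_abs_sub_fHat_le [IsProbabilityMeasure μ]
    (hK : Measurable fun p : A × A => K H p.1 p.2)
    (hX : ∀ t, Measurable (X t)) (hε : ∀ t, Measurable (ε t)) {R D : ℝ} (hR : 0 ≤ R) (f : H)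
    (hf : ‖f‖ ≤ D) (hnoise : IsCondSubGaussianNoise μ R f X ε) : ∀ᵐ ω ∂μ, ∀ t z,
    |f z - fHat H (fun s => X s ω) (fun s => reward f X ε s ω) t z| ≤
      inflation (excess H R (fun s => X s ω) (fun s => ε s ω) t) *
        g H R D (fun s => X s ω) t z := by
  rcases hR.eq_or_lt with rfl | hR
  · have h0 := ae_all_iff.2 (noise_ae_eq_zero f hX (measurable_coe hK f) hε hnoise)
    filter_upwards [h0] with ω hω t z
    refine abs_sub_fHat_le_inflation_mul_g f hf _ _ t (Or.inr ?_) z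
    simp [selfNorm, featureSum, hω]
  · exact Filter.Eventually.of_forall fun ω t z =>
      abs_sub_fHat_le_inflation_mul_g f hf _ _ t (Or.inl hR) z

end Confidence

/-! ### The resampling inequality for one round. -/

section OneRound

/-- The standard Gaussian probability of `[q, q + 1]`. -/
def gaussianWindow (q : ℝ) : ℝ := (gaussianReal 0 1).real (Set.Icc q (q + 1))

theorem measurable_gaussianWindow : Measurable gaussianWindow := by
  have hS : MeasurableSet {p : ℝ × ℝ | p.2 ∈ Set.Icc p.1 (p.1 + 1)} := by
    simp only [Set.mem_Icc]
    exact (measurableSet_le measurable_fst measurable_snd).inter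
      (measurableSet_le measurable_snd (measurable_fst.add_const 1))
  exact (measurable_measure_prodMk_left (ν := gaussianReal 0 1) hS).ennreal_toReal

/-- On the window `x²/2 ≤ 3q²/5 + 3`; at the right end this is `(q-5)² ≥ 0`. The rest of `e^{-8}` is
a crude `e^{-5} ≤ 1/√(2π)`. Any coefficient above 1/2 would be attainable, and `3/5 < log 2` is what
integrability requires. -/
theorem le_gaussianWindow (q : ℝ) :
    Real.exp (-8) * Real.exp (-(3 / 5) * q ^ 2) ≤ gaussianWindow q := by
  have hle : ∀ x ∈ Set.Icc q (q + 1),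
      Real.exp (-8) * Real.exp (-(3 / 5) * q ^ 2) ≤ gaussianPDFReal 0 1 x := by
    rintro x ⟨hx1, hx2⟩
    have h1 : √(2 * Real.pi) ≤ Real.exp 5 := by
      have h3 : √(2 * Real.pi) ≤ 3 :=
        Real.sqrt_le_iff.2 ⟨by norm_num, by linarith [Real.pi_le_four]⟩
      have := Real.add_one_le_exp (5 : ℝ)
      linarith
    have h2 : Real.exp (-5) ≤ (√(2 * Real.pi))⁻¹ := by
      rw [Real.exp_neg]
      exact inv_anti₀ (Real.sqrt_pos.2 (by positivity)) h1
    rw [gaussianPDFReal, NNReal.coe_one, mul_one, mul_one]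
    calc Real.exp (-8) * Real.exp (-(3 / 5) * q ^ 2)
        = Real.exp (-5) * Real.exp (-3 - 3 / 5 * q ^ 2) := by
          rw [← Real.exp_add, ← Real.exp_add]; ring_nf
      _ ≤ (√(2 * Real.pi))⁻¹ * Real.exp (-(x - 0) ^ 2 / 2) := by
          refine mul_le_mul h2 (Real.exp_le_exp.2 ?_) (Real.exp_pos _).le (by positivity)
          nlinarith [sq_nonneg (q - 5)]
  have h1 : gaussianWindow q = ∫ x in Set.Icc q (q + 1), gaussianPDFReal 0 1 x := by
    rw [gaussianWindow, measureReal_def, gaussianReal_apply_eq_integral 0 one_ne_zero,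
      ENNReal.toReal_ofReal (integral_nonneg fun x => gaussianPDFReal_nonneg _ _ _)]
  have h2 := setIntegral_mono_on (μ := volume) (s := Set.Icc q (q + 1))
    (integrableOn_const (by simp)) (integrable_gaussianPDFReal 0 1).integrableOn
    measurableSet_Icc hle
  rw [setIntegral_const] at h2
  rw [h1]
  simpa using h2

theorem gaussianWindow_pos (q : ℝ) : 0 < gaussianWindow q :=
  (by positivity : 0 < Real.exp (-8) * Real.exp (-(3 / 5) * q ^ 2)).trans_le (le_gaussianWindow q)

variable {Ω β A : Type*} [MeasurableSpace Ω] [MeasurableSpace β] [MeasurableSpace A]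
  [StandardBorelSpace A] {μ : Measure Ω}

theorem integrable_of_map_eq_gaussianReal {w : Ω → ℝ} (hw : Measurable w)
    (hlaw : μ.map w = gaussianReal 0 1) : Integrable w μ ∧ ∫ ω, w ω ∂μ = 0 := by
  have h1 : Integrable id (μ.map w) := by
    rw [hlaw]; exact (memLp_id_gaussianReal 1).integrable (by norm_num)
  have h2 := integral_map (μ := μ) hw.aemeasurable (f := id) (by fun_prop)
  rw [hlaw] at h2
  simp only [id, integral_id_gaussianReal] at h2
  exact ⟨(integrable_map_measure (by fun_prop) hw.aemeasurable).1 h1, h2.symm⟩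

/-- The regret of one round, conditionally on the past `Z`, is controlled by the width of the
arm that is played. -/
theorem sub_integral_le [IsProbabilityMeasure μ] [Nonempty A] {Z : Ω → β} (hZ : Measurable Z) {X : Ω → A} (hX : Measurable X)
    {w : Ω → ℝ} (hw : Measurable w) (hlaw : μ.map w = gaussianReal 0 1) (hind : IndepFun Z w μ)
    {m G : β × A → ℝ} (hm : Measurable m) (hG : Measurable G) (hG0 : ∀ p, 0 ≤ G p) {B : ℝ}
    (hGB : ∀ p, G p ≤ B) {q : β → ℝ} (hq : Measurable q) (hq1 : ∀ b, 1 ≤ q b)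
    (hargmax : ∀ ω z, m (Z ω, z) + w ω * G (Z ω, z) ≤ m (Z ω, X ω) + w ω * G (Z ω, X ω))
    {f : A → ℝ} (hf : Integrable (fun ω => f (X ω)) μ)
    (hconf : ∀ᵐ ω ∂μ, ∀ z, |f z - m (Z ω, z)| ≤ q (Z ω) * G (Z ω, z))
    (hqi : Integrable (fun ω => (q (Z ω) + 1) / gaussianWindow (q (Z ω))) μ) (xs : A) :
    f xs - ∫ ω, f (X ω) ∂μ ≤
      ∫ ω, ((q (Z ω) + 1) / gaussianWindow (q (Z ω)) + q (Z ω)) * G (Z ω, X ω) ∂μ +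
        ∫ ω, w ω * G (Z ω, X ω) ∂μ := by
  set ρ := condDistrib (fun ω => (w ω, X ω)) Z μ with hρ
  have hwX : Measurable fun ω => (w ω, X ω) := hw.prodMk hX
  have hcomp : (μ.map Z) ⊗ₘ ρ = μ.map fun ω => (Z ω, (w ω, X ω)) :=
    compProd_map_condDistrib hwX.aemeasurable
  -- Independence of the past keeps the conditional law of `w` standard Gaussian, so the resampled
  -- `w'` hits the window with probability `gaussianWindow q`.
  have hfst : ∀ᵐ ω ∂μ, (ρ (Z ω)).map Prod.fst = gaussianReal 0 1 := by
    refine ae_of_ae_map hZ.aemeasurable (p := fun b => (ρ b).map Prod.fst = gaussianReal 0 1) ?_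
    have h1 := condDistrib_comp (μ := μ) (mβ := ‹MeasurableSpace β›) Z hwX.aemeasurable
      (measurable_fst : Measurable (Prod.fst : ℝ × A → ℝ))
    have h2 : condDistrib w Z μ =ᵐ[μ.map Z] Kernel.const β (μ.map w) := by
      have := Measure.isProbabilityMeasure_map (μ := μ) hw.aemeasurable
      refine condDistrib_ae_eq_of_measure_eq_compProd _ hw.aemeasurable ?_
      rw [Measure.compProd_const]
      exact (indepFun_iff_map_prod_eq_prod_map_map hZ.aemeasurable hw.aemeasurable).1 hind
    filter_upwards [h1, h2] with b h1 h2
    rw [← Kernel.map_apply _ measurable_fst, ← h1]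
    change condDistrib w Z μ b = _
    rw [h2, Kernel.const_apply, hlaw]
  have hbest : ∀ᵐ ω ∂μ, ∀ᵐ p ∂(ρ (Z ω)),
      m (Z ω, xs) + p.1 * G (Z ω, xs) ≤ m (Z ω, p.2) + p.1 * G (Z ω, p.2) := by
    refine ae_of_ae_map hZ.aemeasurable (p := fun b => ∀ᵐ p ∂(ρ b),
      m (b, xs) + p.1 * G (b, xs) ≤ m (b, p.2) + p.1 * G (b, p.2)) ?_
    refine Measure.ae_ae_of_ae_compProd (p := fun x : β × (ℝ × A) =>
      m (x.1, xs) + x.2.1 * G (x.1, xs) ≤ m (x.1, x.2.2) + x.2.1 * G (x.1, x.2.2)) ?_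
    rw [hcomp, ae_map_iff (by fun_prop) (measurableSet_le (by fun_prop) (by fun_prop))]
    exact Filter.Eventually.of_forall fun ω => hargmax ω xs
  set E : Set (β × (ℝ × A)) := {x | q x.1 ≤ x.2.1 ∧ x.2.1 ≤ q x.1 + 1} with hE
  have hq' : Measurable fun x : β × (ℝ × A) => q x.1 := hq.comp measurable_fst
  have hw' : Measurable fun x : β × (ℝ × A) => x.2.1 := by fun_prop
  have hEm : MeasurableSet E :=
    (measurableSet_le hq' hw').inter (measurableSet_le hw' (hq'.add_const 1))
  set Γ : β → ℝ := fun b => ∫ p, E.indicator (fun x => G (x.1, x.2.2)) (b, p) ∂(ρ b) with hΓ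
  have hindm : Measurable (E.indicator fun x : β × (ℝ × A) => G (x.1, x.2.2)) :=
    Measurable.indicator (by fun_prop) hEm
  have hΓm : Measurable Γ :=
    (StronglyMeasurable.integral_kernel_prod_right' hindm.stronglyMeasurable).measurable
  have hind0 : ∀ x, 0 ≤ E.indicator (fun x : β × (ℝ × A) => G (x.1, x.2.2)) x := fun x =>
    Set.indicator_nonneg (fun _ _ => hG0 _) x
  have hΓ0 : ∀ b, 0 ≤ Γ b := fun b => integral_nonneg fun p => hind0 _
  set Φ : β → ℝ := fun b => Γ b / gaussianWindow (q b) with hΦ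
  have hΦm : Measurable Φ := hΓm.div (measurable_gaussianWindow.comp hq)
  have hp : ∀ b, 0 < gaussianWindow (q b) := fun b => gaussianWindow_pos (q b)
  have hΦ0 : ∀ b, 0 ≤ Φ b := fun b => div_nonneg (hΓ0 b) (hp b).le
  have hsec : ∀ b, MeasurableSet {p : ℝ × A | (b, p) ∈ E} := fun b => measurable_prodMk_left hEm
  have hEp : ∀ ω, (ρ (Z ω)).map Prod.fst = gaussianReal 0 1 →
      (ρ (Z ω)).real {p | (Z ω, p) ∈ E} = gaussianWindow (q (Z ω)) := by
    intro ω h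
    rw [gaussianWindow, ← h, map_measureReal_apply measurable_fst measurableSet_Icc]
    rfl
  have hΓset : ∀ b, Γ b = ∫ p in {p : ℝ × A | (b, p) ∈ E}, G (b, p.2) ∂(ρ b) := fun b => by
    rw [← integral_indicator (hsec b)]
    rfl
  have hGi : ∀ b, Integrable (fun p : ℝ × A => G (b, p.2)) (ρ b) := fun b =>
    Integrable.of_bound (by fun_prop : Measurable fun p : ℝ × A => G (b, p.2)).aestronglyMeasurable
      B (Filter.Eventually.of_forall fun p => by
        rw [Real.norm_eq_abs, abs_of_nonneg (hG0 _)]; exact hGB _)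
  have hB0 : 0 ≤ B := by
    obtain ⟨ω⟩ := μ.nonempty_of_neZero
    exact (hG0 (Z ω, X ω)).trans (hGB _)
  -- `Φ` is the mean of `G` at the resampled arm, conditioned on the window event, so it inherits
  -- the bound `B`.
  have hΦB : ∀ᵐ ω ∂μ, Φ (Z ω) ≤ B := by
    filter_upwards [hfst] with ω hω
    rw [hΦ]
    simp only
    rw [div_le_iff₀ (hp _), hΓset, ← hEp ω hω]
    refine (setIntegral_mono (hGi _).integrableOn (integrable_const B).integrableOn
      fun p => hGB _).trans ?_
    rw [setIntegral_const, smul_eq_mul, mul_comm]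
  have hpoint : ∀ᵐ ω ∂μ, f xs - f (X ω) ≤ (q (Z ω) + 1) * Φ (Z ω) - w ω * Φ (Z ω) +
      q (Z ω) * G (Z ω, X ω) + w ω * G (Z ω, X ω) := by
    filter_upwards [hfst, hbest, hconf] with ω h1 h2 h3
    set h := m (Z ω, X ω) + w ω * G (Z ω, X ω) with hh
    -- For a resampled `p = (w', X')` in the window, `f xs ≤ m(X') + w' G(X')` by confidence and
    -- optimality, and `h ≥ m(X') + w G(X')`. Their difference is at most `(q + 1 - w) G(X')`;
    -- integrate over the window.
    have h4 : (f xs - h) * gaussianWindow (q (Z ω)) ≤ (q (Z ω) + 1 - w ω) * Γ (Z ω) := by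
      rw [hΓset, ← hEp ω h1, ← integral_const_mul, mul_comm, ← smul_eq_mul, ← setIntegral_const]
      refine setIntegral_mono_on_ae (integrable_const _).integrableOn
        ((hGi _).const_mul _).integrableOn (hsec _) ?_
      filter_upwards [h2] with p hp2 ⟨hp3, hp4⟩
      have h5 := (abs_le.1 (h3 xs)).2
      have h6 := hargmax ω p.2
      have h7 := hG0 (Z ω, xs)
      have h8 := hG0 (Z ω, p.2)
      simp only at hp3 hp4
      nlinarith
    have h9 : f xs - h ≤ (q (Z ω) + 1) * Φ (Z ω) - w ω * Φ (Z ω) := by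
      rw [← sub_mul, hΦ]
      simp only
      rwa [← mul_div_assoc, le_div_iff₀ (hp _)]
    have h10 := (abs_le.1 (h3 (X ω))).1
    linarith
  obtain ⟨hwi, hw0⟩ := integrable_of_map_eq_gaussianReal hw hlaw
  have hGb : ∀ᵐ ω ∂μ, ‖G (Z ω, X ω)‖ ≤ B := Filter.Eventually.of_forall fun ω => by
    rw [Real.norm_eq_abs, abs_of_nonneg (hG0 _)]; exact hGB _
  have hΦb : ∀ᵐ ω ∂μ, ‖Φ (Z ω)‖ ≤ B := by
    filter_upwards [hΦB] with ω hω
    rwa [Real.norm_eq_abs, abs_of_nonneg (hΦ0 _)]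
  have hwin1 : ∀ b, gaussianWindow (q b) ≤ 1 := fun b => measureReal_le_one
  have hqle : ∀ b, q b + 1 ≤ (q b + 1) / gaussianWindow (q b) := fun b => by
    rw [le_div_iff₀ (hp b)]
    nlinarith [hwin1 b, hq1 b]
  have hqi1 : Integrable (fun ω => q (Z ω) + 1) μ := by
    refine hqi.mono' ((hq.comp hZ).add_const 1).aestronglyMeasurable (Filter.Eventually.of_forall fun ω => ?_)
    rw [Real.norm_eq_abs, abs_of_nonneg (by linarith [hq1 (Z ω)])]
    exact hqle _
  have hqi0 : Integrable (fun ω => q (Z ω)) μ := by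
    simpa [Pi.sub_def] using hqi1.sub (integrable_const (1 : ℝ))
  have hGXm : Measurable fun ω => G (Z ω, X ω) := by fun_prop
  have hΦZm : Measurable fun ω => Φ (Z ω) := hΦm.comp hZ
  have i1 : Integrable (fun ω => (q (Z ω) + 1) * Φ (Z ω)) μ :=
    hqi1.mul_bdd hΦZm.aestronglyMeasurable hΦb
  have i2 : Integrable (fun ω => w ω * Φ (Z ω)) μ :=
    hwi.mul_bdd hΦZm.aestronglyMeasurable hΦb
  have i3 : Integrable (fun ω => q (Z ω) * G (Z ω, X ω)) μ :=
    hqi0.mul_bdd hGXm.aestronglyMeasurable hGb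
  have i4 : Integrable (fun ω => w ω * G (Z ω, X ω)) μ :=
    hwi.mul_bdd hGXm.aestronglyMeasurable hGb
  have i5 : Integrable (fun ω => (q (Z ω) + 1) / gaussianWindow (q (Z ω)) * G (Z ω, X ω)) μ :=
    hqi.mul_bdd hGXm.aestronglyMeasurable hGb
  -- `Φ` depends only on the past, unlike `G (Z, X)`, so the mean-zero `w` averages out.
  have e2 : ∫ ω, w ω * Φ (Z ω) ∂μ = 0 := by
    have hi : IndepFun w (fun ω => Φ (Z ω)) μ := hind.symm.comp measurable_id hΦm
    rw [hi.integral_fun_mul_eq_mul_integral hwi.aestronglyMeasurable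
      hΦZm.aestronglyMeasurable, hw0, zero_mul]
  have e1 : ∫ ω, (q (Z ω) + 1) * Φ (Z ω) ∂μ ≤
      ∫ ω, (q (Z ω) + 1) / gaussianWindow (q (Z ω)) * G (Z ω, X ω) ∂μ := by
    set F : β × (ℝ × A) → ℝ := fun x => (q x.1 + 1) / gaussianWindow (q x.1) *
      E.indicator (fun x => G (x.1, x.2.2)) x with hF
    have hFm : Measurable F := Measurable.mul
      (((hq.comp measurable_fst).add_const 1).div
        (measurable_gaussianWindow.comp (hq.comp measurable_fst))) hindm
    have hFle : ∀ ω, F (Z ω, (w ω, X ω)) ≤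
        (q (Z ω) + 1) / gaussianWindow (q (Z ω)) * G (Z ω, X ω) := fun ω => by
      refine mul_le_mul_of_nonneg_left ?_
        (div_nonneg (by linarith [hq1 (Z ω)]) (hp (Z ω)).le)
      exact Set.indicator_le_self' (fun _ _ => hG0 _) _
    have hF0 : ∀ x, 0 ≤ F x := fun x =>
      mul_nonneg (div_nonneg (by linarith [hq1 x.1]) (hp x.1).le) (hind0 x)
    have hFi : Integrable (fun ω => F (Z ω, (w ω, X ω))) μ := by
      refine i5.mono' (hFm.comp (hZ.prodMk hwX)).aestronglyMeasurable (Filter.Eventually.of_forall fun ω => ?_)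
      rw [Real.norm_eq_abs, abs_of_nonneg (hF0 _)]
      exact hFle ω
    have hFi' : Integrable F ((μ.map Z) ⊗ₘ ρ) := by
      rw [hcomp]
      exact (integrable_map_measure hFm.aestronglyMeasurable (by fun_prop)).2 hFi
    have h1 : ∫ ω, F (Z ω, (w ω, X ω)) ∂μ = ∫ ω, (q (Z ω) + 1) * Φ (Z ω) ∂μ := by
      rw [← integral_map (φ := fun ω => (Z ω, (w ω, X ω))) (by fun_prop)
        hFm.aestronglyMeasurable, ← hcomp, Measure.integral_compProd hFi',
        integral_map hZ.aemeasurable]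
      · refine integral_congr_ae (Filter.Eventually.of_forall fun ω => ?_)
        simp only [hF, integral_const_mul]
        rw [hΦ]
        simp only [hΓ]
        ring
      · exact (StronglyMeasurable.integral_kernel_prod_right'
          hFm.stronglyMeasurable).aestronglyMeasurable
    rw [← h1]
    exact integral_mono hFi i5 hFle
  have hfin : ∫ ω, (f xs - f (X ω)) ∂μ ≤ ∫ ω, ((q (Z ω) + 1) * Φ (Z ω) - w ω * Φ (Z ω) +
      q (Z ω) * G (Z ω, X ω) + w ω * G (Z ω, X ω)) ∂μ :=
    integral_mono_ae ((integrable_const _).sub hf) (((i1.sub i2).add i3).add i4) hpoint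
  have s1 : ∫ ω, (f xs - f (X ω)) ∂μ = f xs - ∫ ω, f (X ω) ∂μ := by
    rw [integral_sub (integrable_const _) hf]; simp
  have s2 := integral_add ((i1.sub i2).add i3) i4
  have s3 := integral_add (i1.sub i2) i3
  have s4 := integral_sub i1 i2
  have s5 := integral_add i5 i3
  simp only [Pi.add_apply, Pi.sub_apply] at s2 s3 s4 s5
  simp_rw [add_mul] at *
  linarith

end OneRound

/-! ### Summation over the rounds. -/

section Regret

/-- The price of resampling an optimistic arm when the confidence width is inflated by `q`. -/
def resamplingCost (q : ℝ) : ℝ := (q + 1) / gaussianWindow q + q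

/-- The exponents add up to `1 + 25/2 + 8 + (1/50 + 3/5) q²`. Since `q² = 1 + u / log 2` and `log 2
> 31/45`, this is at most `23 + 0.9u`. -/
theorem resamplingCost_inflation_le {u : ℝ} (hu : 0 ≤ u) :
    resamplingCost (inflation u) ≤ Real.exp 23 * Real.exp (9 / 10 * u) := by
  have hq := one_le_inflation hu
  have hsq := inflation_sq hu
  set q := inflation u
  have h2 : (0.6931471803 : ℝ) < Real.log 2 := Real.log_two_gt_d9
  have h1 : q + 1 ≤ Real.exp (25 / 2) * Real.exp (1 / 50 * q ^ 2) := by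
    rw [← Real.exp_add]
    exact (Real.add_one_le_exp q).trans (Real.exp_le_exp.2 (by nlinarith [sq_nonneg (q - 25)]))
  have h3 : (gaussianWindow q)⁻¹ ≤ Real.exp 8 * Real.exp (3 / 5 * q ^ 2) := by
    refine (inv_anti₀ (by positivity) (le_gaussianWindow q)).trans (le_of_eq ?_)
    rw [← Real.exp_add, ← Real.exp_add, ← Real.exp_neg]
    ring_nf
  have h4 : (1 : ℝ) ≤ Real.exp 8 * Real.exp (3 / 5 * q ^ 2) := by
    rw [← Real.exp_add]; exact Real.one_le_exp (by positivity)
  have h5 : (31 / 50) * q ^ 2 ≤ 31 / 50 + 9 / 10 * u := by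
    have : u / Real.log 2 ≤ u * (45 / 31) := by
      rw [div_le_iff₀ (by linarith)]
      nlinarith
    rw [hsq]; linarith
  have h6 : (2 : ℝ) ≤ Real.exp 1 := by have := Real.add_one_le_exp (1 : ℝ); linarith
  have h7 : resamplingCost q ≤ 2 * ((q + 1) * (Real.exp 8 * Real.exp (3 / 5 * q ^ 2))) := by
    rw [resamplingCost, div_eq_mul_inv]
    have := mul_le_mul_of_nonneg_left h3 (by linarith : 0 ≤ q + 1)
    have := mul_le_mul_of_nonneg_left h4 (by linarith : 0 ≤ q + 1)
    linarith
  calc resamplingCost q ≤ 2 * ((q + 1) * (Real.exp 8 * Real.exp (3 / 5 * q ^ 2))) := h7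
    _ ≤ Real.exp 1 * ((Real.exp (25 / 2) * Real.exp (1 / 50 * q ^ 2)) *
        (Real.exp 8 * Real.exp (3 / 5 * q ^ 2))) := by gcongr
    _ = Real.exp (43 / 2 + 31 / 50 * q ^ 2) := by
        simp only [← Real.exp_add]; ring_nf
    _ ≤ Real.exp 23 * Real.exp (9 / 10 * u) := by
        rw [← Real.exp_add]; exact Real.exp_le_exp.2 (by linarith)

section Widths

variable {A : Type*} (H : Type*) [NormedAddCommGroup H] [InnerProductSpace ℝ H]
  [CompleteSpace H] [RKHS ℝ H A ℝ]

/-- A uniform bound for the exploration functions up to time `T`. -/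
def explorationBound (R D : ℝ) (T : ℕ) : ℝ :=
  √(2 * R ^ 2 * (Real.log 2 + infoGain H T)) + D

variable {H}

theorem explorationBound_nonneg (R : ℝ) {D : ℝ} (hD : 0 ≤ D) (T : ℕ) :
    0 ≤ explorationBound H R D T := add_nonneg (Real.sqrt_nonneg _) hD

theorem g_nonneg (R : ℝ) {D : ℝ} (hD : 0 ≤ D) (x : ℕ → A) (t : ℕ) (z : A) :
    0 ≤ g H R D x t z :=
  mul_nonneg (add_nonneg (Real.sqrt_nonneg _) hD) (Real.sqrt_nonneg _)

theorem g_le_explorationBound_mul_width (hK : ∀ z : A, K H z z ≤ 1) (R D : ℝ) (x : ℕ → A)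
    {t T : ℕ} (ht : t ≤ T) (z : A) :
    g H R D x t z ≤ explorationBound H R D T * width H x t z := by
  refine mul_le_mul_of_nonneg_right ?_ (Real.sqrt_nonneg _)
  refine add_le_add (Real.sqrt_le_sqrt (mul_le_mul_of_nonneg_left ?_ (by positivity))) le_rfl
  have hd := detVbar_pos H x t
  rw [Real.log_mul two_ne_zero (Real.sqrt_pos.2 hd).ne', Real.log_sqrt hd.le]
  have h1 := Real.log_le_log hd (detVbar_mono H x ht)
  have h2 := log_detVbar_le H hK x T
  linarith

theorem width_le_one (hK : ∀ z : A, K H z z ≤ 1) (x : ℕ → A) (t : ℕ) (z : A) :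
    width H x t z ≤ 1 := by
  rw [width_eq, Real.sqrt_le_one]
  exact (postCov_self_le H x t z).trans (hK z)

theorem sum_g_sq_le (hK : ∀ z : A, K H z z ≤ 1) (R : ℝ) {D : ℝ} (hD : 0 ≤ D) (x : ℕ → A)
    (T : ℕ) : ∑ t ∈ Finset.range T, g H R D x t (x t) ^ 2 ≤
      (2 * explorationBound H R D T * √(infoGain H T)) ^ 2 := by
  have h1 : ∀ t ∈ Finset.range T, g H R D x t (x t) ^ 2 ≤
      explorationBound H R D T ^ 2 * postCov H x t (x t) (x t) := fun t ht => by
    refine (pow_le_pow_left₀ (g_nonneg R hD x t _)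
      (g_le_explorationBound_mul_width hK R D x (Finset.mem_range.1 ht).le _) 2).trans ?_
    rw [mul_pow, width_eq, Real.sq_sqrt (postCov_self_nonneg H x t _)]
  refine (Finset.sum_le_sum h1).trans ?_
  rw [← Finset.mul_sum, mul_pow, mul_pow, Real.sq_sqrt (infoGain_nonneg H T)]
  have h2 := sum_postCov_le H hK x T
  have h3 := log_detVbar_le H hK x T
  have h4 := mul_le_mul_of_nonneg_left (h2.trans (by linarith : _ ≤ 4 * infoGain H T))
    (sq_nonneg (explorationBound H R D T))
  linarith

theorem sum_mul_g_le (hK : ∀ z : A, K H z z ≤ 1) (R : ℝ) {D : ℝ} (hD : 0 ≤ D) (x : ℕ → A)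
    {T : ℕ} (hT : 0 < T) (v : ℕ → ℝ) : ∑ t ∈ Finset.range T, v t * g H R D x t (x t) ≤
      ((∑ t ∈ Finset.range T, v t ^ 2) / T + 1) / 2 *
        (2 * √T * explorationBound H R D T * √(infoGain H T)) := by
  have h0 := Real.sum_mul_le_sqrt_mul_sqrt (Finset.range T) v fun t => g H R D x t (x t)
  have hB := explorationBound_nonneg (H := H) R hD T
  have h1 : √(∑ t ∈ Finset.range T, g H R D x t (x t) ^ 2) ≤
      2 * explorationBound H R D T * √(infoGain H T) :=
    Real.sqrt_le_iff.2 ⟨by positivity, sum_g_sq_le hK R hD x T⟩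
  have hT' : (0 : ℝ) < T := Nat.cast_pos.2 hT
  have hs : 0 ≤ ∑ t ∈ Finset.range T, v t ^ 2 := Finset.sum_nonneg fun t _ => sq_nonneg _
  set s := ∑ t ∈ Finset.range T, v t ^ 2
  -- AM–GM makes the bound affine in `∑ v_t²`, so that its expectation can be taken when `v_t =
  -- w_t`.
  have h2 : √s ≤ (s / T + 1) / 2 * √T := by
    refine Real.sqrt_le_iff.2 ⟨by positivity, ?_⟩
    rw [mul_pow, Real.sq_sqrt hT'.le]
    have h3 : s = s / T * T := by field_simp
    nlinarith [sq_nonneg (s / T - 1)]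
  calc _ ≤ √s * √(∑ t ∈ Finset.range T, g H R D x t (x t) ^ 2) := h0
    _ ≤ ((s / T + 1) / 2 * √T) * (2 * explorationBound H R D T * √(infoGain H T)) :=
      mul_le_mul h2 h1 (Real.sqrt_nonneg _) (by positivity)
    _ = _ := by ring

theorem sum_g_le (hK : ∀ z : A, K H z z ≤ 1) (R : ℝ) {D : ℝ} (hD : 0 ≤ D) (x : ℕ → A)
    {T : ℕ} (hT : 0 < T) : ∑ t ∈ Finset.range T, g H R D x t (x t) ≤
      2 * √T * explorationBound H R D T * √(infoGain H T) := by
  have h := sum_mul_g_le hK R hD x hT fun _ => 1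
  have hT' : (T : ℝ) ≠ 0 := Nat.cast_ne_zero.2 hT.ne'
  simpa [hT'] using h

theorem abs_coe_le {D : ℝ} (f : H) (hf : ‖f‖ ≤ D) (z : A) : |f z| ≤ D * √(K H z z) := by
  have h1 : |f z| ≤ ‖feature H z‖ * ‖f‖ := by
    rw [← inner_feature_left]; exact abs_real_inner_le_norm _ _
  have h2 : ‖feature H z‖ = √(K H z z) := by
    rw [K, ← inner_feature_left, real_inner_self_eq_norm_sq, Real.sqrt_sq (norm_nonneg _)]
  rw [h2] at h1
  nlinarith [Real.sqrt_nonneg (K H z z)]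

/-- Repeating `z` gives `T K(z, z) ≤ e^{2γ} - 1 ≤ 2γ + 4γ² ≤ 4γ`. -/
theorem kernel_le_of_infoGain_le (hK : ∀ z : A, K H z z ≤ 1) {T : ℕ} (hT : 0 < T)
    (hγ : infoGain H T ≤ 1 / 2) (z : A) : K H z z ≤ 4 * infoGain H T / T := by
  have hT' : (0 : ℝ) < T := Nat.cast_pos.2 hT
  have h0 := infoGain_nonneg H T
  have hK0 : 0 ≤ K H z z := by
    have := postCov_self_nonneg H (fun _ => z) 0 z
    rwa [postCov_zero] at this
  have h1 := log_one_add_mul_le_infoGain H hK z T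
  rw [Real.log_le_iff_le_exp (by positivity)] at h1
  have h2 := Real.abs_exp_sub_one_sub_id_le (x := 2 * infoGain H T)
    (by rw [abs_of_nonneg (by linarith)]; linarith)
  have h3 := (abs_le.1 h2).2
  rw [le_div_iff₀ hT']
  nlinarith

theorem resamplingCost_excess_le {Ω : Type*} (R : ℝ) (X : ℕ → Ω → A) (ε : ℕ → Ω → ℝ) {t T : ℕ} (ht : t ≤ T)
    (ω : Ω) : resamplingCost (inflation (excess H R (fun s => X s ω) (fun s => ε s ω) t)) ≤
      Real.exp 23 * Real.exp (9 / 10 * maxExcess H R X ε T ω) := by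
  refine (resamplingCost_inflation_le (excess_nonneg H R _ _ t)).trans ?_
  have := excess_le_maxExcess H R X ε ht ω
  gcongr

end Widths

variable {A : Type*} [MeasurableSpace A] {H : Type*} [NormedAddCommGroup H]
  [InnerProductSpace ℝ H] [CompleteSpace H] [RKHS ℝ H A ℝ] {Ω : Type*} [m0 : MeasurableSpace Ω]
  {μ : Measure Ω} {R D : ℝ} {f : H} {X : ℕ → Ω → A} {ε w : ℕ → Ω → ℝ}

theorem integral_sq_of_map_eq_gaussianReal {v : Ω → ℝ} (hv : Measurable v)
    (hlaw : μ.map v = gaussianReal 0 1) :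
    Integrable (fun ω => v ω ^ 2) μ ∧ ∫ ω, v ω ^ 2 ∂μ = 1 := by
  have h1 : Integrable (fun x => x ^ 2) (μ.map v) := by
    rw [hlaw]; exact (memLp_id_gaussianReal 2).integrable_sq
  have h2 := integral_map (μ := μ) hv.aemeasurable (f := fun x => x ^ 2) (by fun_prop)
  have h3 := variance_id_gaussianReal (μ := 0) (v := 1)
  rw [variance_of_integral_eq_zero (by fun_prop) (by simp)] at h3
  rw [hlaw] at h2
  refine ⟨(integrable_map_measure (by fun_prop) hv.aemeasurable).1 h1, ?_⟩
  rw [← h2]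
  simpa using h3

variable [IsProbabilityMeasure μ]

theorem integrable_coe_comp (hKm : Measurable fun p : A × A => K H p.1 p.2)
    (hK : ∀ z : A, K H z z ≤ 1) (f : H) {Y : Ω → A} (hY : Measurable Y) :
    Integrable (fun ω => f (Y ω)) μ := by
  refine Integrable.of_bound ((measurable_coe hKm f).comp hY).aestronglyMeasurable ‖f‖
    (Filter.Eventually.of_forall fun ω => ?_)
  refine (abs_coe_le f le_rfl _).trans ?_
  exact mul_le_of_le_one_right (norm_nonneg f) (Real.sqrt_le_one.2 (hK _))

theorem integrable_exp_maxExcess (hKm : Measurable fun p : A × A => K H p.1 p.2)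
    (hR : 0 ≤ R) (hX : ∀ t, Measurable (X t)) (hε : ∀ t, Measurable (ε t))
    (hnoise : IsCondSubGaussianNoise μ R f X ε) (T : ℕ) :
    Integrable (fun ω => Real.exp (9 / 10 * maxExcess H R X ε T ω)) μ ∧
      ∫ ω, Real.exp (9 / 10 * maxExcess H R X ε T ω) ∂μ ≤ 10 := by
  have h := lintegral_exp_maxExcess_le hKm hX hε hR f hnoise T
  have hm : Measurable fun ω => Real.exp (9 / 10 * maxExcess H R X ε T ω) :=
    ((measurable_maxExcess hKm R T hX hε).const_mul _).exp
  have h0 : 0 ≤ᵐ[μ] fun ω => Real.exp (9 / 10 * maxExcess H R X ε T ω) :=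
    Filter.Eventually.of_forall fun ω => (Real.exp_pos _).le
  refine ⟨⟨hm.aestronglyMeasurable, ?_⟩, ?_⟩
  · rw [hasFiniteIntegral_iff_ofReal h0]
    exact h.trans_lt (by simp)
  · rw [integral_eq_lintegral_of_nonneg_ae h0 hm.aestronglyMeasurable]
    exact ENNReal.toReal_le_of_le_ofReal (by norm_num) (by simpa using h)

theorem sub_integral_le_of_run [StandardBorelSpace A] (hKm : Measurable fun p : A × A => K H p.1 p.2)
    (hK : ∀ z : A, K H z z ≤ 1) (hR : 0 ≤ R) (hf : ‖f‖ ≤ D)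
    (run : IsSimpleGaussianRun H μ R D f X ε w) (xs : A) (t : ℕ) :
    f xs - ∫ ω, f (X t ω) ∂μ ≤
      ∫ ω, resamplingCost (inflation (excess H R (fun s => X s ω) (fun s => ε s ω) t)) *
        g H R D (fun s => X s ω) t (X t ω) ∂μ +
      ∫ ω, w t ω * g H R D (fun s => X s ω) t (X t ω) ∂μ := by
  have hX := run.measurable_arm
  have hε := run.measurable_noise
  have hD : 0 ≤ D := (norm_nonneg f).trans hf
  have hfm := measurable_coe hKm f
  have hY : ∀ t, Measurable (reward f X ε t) := fun t => (hfm.comp (hX t)).add (hε t)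
  have hFle := history_le hX hY t
  have hid : @Measurable Ω Ω m0 (history X (reward f X ε) t) id := measurable_id'' hFle
  have hconf := ae_abs_sub_fHat_le (D := D) hKm hX hε hR f hf run.noise
  have hqi : Integrable (fun ω =>
      (inflation (excess H R (fun s => X s ω) (fun s => ε s ω) t) + 1) /
        gaussianWindow (inflation (excess H R (fun s => X s ω) (fun s => ε s ω) t))) μ := by
    have hm : Measurable fun ω => inflation (excess H R (fun s => X s ω) (fun s => ε s ω) t) :=
      (((measurable_excess hKm R (fun s _ => hX s) (fun s _ => hε s)).div_const _).const_add 1).sqrt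
    refine ((integrable_exp_maxExcess hKm hR hX hε run.noise t).1.const_mul (Real.exp 23)).mono'
      ((hm.add_const 1).div (measurable_gaussianWindow.comp hm)).aestronglyMeasurable
      (Filter.Eventually.of_forall fun ω => ?_)
    have h1 := one_le_inflation (excess_nonneg H R (fun s => X s ω) (fun s => ε s ω) t)
    have h2 := resamplingCost_excess_le (H := H) R X ε le_rfl (t := t) ω
    rw [Real.norm_eq_abs, abs_of_nonneg (div_nonneg (by linarith) (gaussianWindow_pos _).le)]
    rw [resamplingCost] at h2
    linarith
  have hind : @IndepFun Ω Ω ℝ m0 (history X (reward f X ε) t) _ id (w t) μ := by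
    refine (@IndepFun_iff_Indep Ω Ω ℝ m0 (history X (reward f X ε) t) _ id (w t) μ).2 ?_
    rw [MeasurableSpace.comap_id]
    exact (run.indep_history t).symm
  have hfi := integrable_coe_comp (μ := μ) hKm hK f (hX t)
  have hGB : ∀ p : Ω × A, g H R D (fun s => X s p.1) t p.2 ≤ explorationBound H R D t := fun p =>
    (g_le_explorationBound_mul_width hK R D _ le_rfl _).trans
      (mul_le_of_le_one_right (explorationBound_nonneg R hD t) (width_le_one hK _ _ _))
  have : Nonempty A := ⟨xs⟩
  have hargmax := run.argmax t
  have hwm := run.measurable_exploration t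
  have hwlaw := run.law_exploration t
  have hconf_t := hconf.mono fun ω h => h t
  set F : MeasurableSpace Ω := history X (reward f X ε) t with hF
  have hXs : ∀ s < t, Measurable[F] (X s) := fun s hs => measurable_arm_history X _ hs
  have hYs : ∀ s < t, Measurable[F] (reward f X ε s) := fun s hs =>
    measurable_reward_history X _ hs
  have hεs : ∀ s < t, Measurable[F] (ε s) := fun s hs => measurable_noise_history hfm X ε hs
  exact @sub_integral_le Ω Ω A m0 F _ _ μ _ _ id hid (X t) (hX t) (w t)
    hwm hwlaw hind
    (fun p => fHat H (fun s => X s p.1) (fun s => reward f X ε s p.1) t p.2)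
    (fun p => g H R D (fun s => X s p.1) t p.2)
    (@measurable_fHat _ _ _ _ _ _ _ _ F _ _ _ (@Prod.instMeasurableSpace _ _ F _) hKm t hXs hYs
      Prod.fst Prod.snd measurable_fst measurable_snd)
    (@measurable_g _ _ _ _ _ _ _ _ F _ _ (@Prod.instMeasurableSpace _ _ F _) hKm R D t hXs
      Prod.fst Prod.snd measurable_fst measurable_snd)
    (fun p => g_nonneg R hD _ t _) (explorationBound H R D t) hGB
    (fun ω => inflation (excess H R (fun s => X s ω) (fun s => ε s ω) t))
    (Measurable.sqrt (Measurable.const_add (Measurable.div_const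
      (@measurable_excess _ _ _ _ _ _ _ _ F _ _ hKm R t hXs hεs) _) 1))
    (fun ω => one_le_inflation (excess_nonneg H R _ _ t))
    hargmax f hfi hconf_t hqi xs

theorem regret_le_of_run [StandardBorelSpace A] (hKm : Measurable fun p : A × A => K H p.1 p.2)
    (hK : ∀ z : A, K H z z ≤ 1) (hR : 0 ≤ R) (hf : ‖f‖ ≤ D)
    (run : IsSimpleGaussianRun H μ R D f X ε w) (xs : A) {T : ℕ} (hT : 0 < T) :
    regret μ f xs X T ≤ (10 * Real.exp 23 + 1) *
      (2 * √T * explorationBound H R D T * √(infoGain H T)) := by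
  have hX := run.measurable_arm
  have hε := run.measurable_noise
  have hD : 0 ≤ D := (norm_nonneg f).trans hf
  set Q := 2 * √T * explorationBound H R D T * √(infoGain H T) with hQ
  have hB := explorationBound_nonneg (H := H) R hD T
  have hQ0 : 0 ≤ Q := by positivity
  set G : ℕ → Ω → ℝ := fun t ω => g H R D (fun s => X s ω) t (X t ω) with hG
  set c : ℕ → Ω → ℝ := fun t ω =>
    resamplingCost (inflation (excess H R (fun s => X s ω) (fun s => ε s ω) t)) with hc
  have hGm : ∀ t, Measurable (G t) := fun t =>
    measurable_g hKm R D (fun s _ => hX s) measurable_id (hX t)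
  have hG0 : ∀ t ω, 0 ≤ G t ω := fun t ω => g_nonneg R hD _ t _
  have hGB : ∀ t ∈ Finset.range T, ∀ᵐ ω ∂μ, ‖G t ω‖ ≤ explorationBound H R D T := fun t ht =>
    Filter.Eventually.of_forall fun ω => by
      rw [Real.norm_eq_abs, abs_of_nonneg (hG0 t ω)]
      exact (g_le_explorationBound_mul_width hK R D _ (Finset.mem_range.1 ht).le _).trans
        (mul_le_of_le_one_right hB (width_le_one hK _ _ _))
  obtain ⟨hEi, hE⟩ := integrable_exp_maxExcess hKm hR hX hε run.noise T
  have hcm : ∀ t, Measurable (c t) := fun t => by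
    have hm : Measurable fun ω => inflation (excess H R (fun s => X s ω) (fun s => ε s ω) t) :=
      (((measurable_excess hKm R (fun s _ => hX s) (fun s _ => hε s)).div_const _).const_add 1).sqrt
    exact ((hm.add_const 1).div (measurable_gaussianWindow.comp hm)).add hm
  have hc0 : ∀ t ω, 0 ≤ c t ω := fun t ω => by
    have := one_le_inflation (excess_nonneg H R (fun s => X s ω) (fun s => ε s ω) t)
    exact add_nonneg (div_nonneg (by linarith) (gaussianWindow_pos _).le) (by linarith)
  have hcle : ∀ t ∈ Finset.range T, ∀ ω,
      c t ω ≤ Real.exp 23 * Real.exp (9 / 10 * maxExcess H R X ε T ω) := fun t ht ω =>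
    resamplingCost_excess_le R X ε (Finset.mem_range.1 ht).le ω
  have hci : ∀ t ∈ Finset.range T, Integrable (fun ω => c t ω * G t ω) μ := fun t ht => by
    refine Integrable.mul_bdd ?_ (hGm t).aestronglyMeasurable (hGB t ht)
    refine (hEi.const_mul (Real.exp 23)).mono' (hcm t).aestronglyMeasurable
      (Filter.Eventually.of_forall fun ω => ?_)
    rw [Real.norm_eq_abs, abs_of_nonneg (hc0 t ω)]
    exact hcle t ht ω
  have hwi : ∀ t ∈ Finset.range T, Integrable (fun ω => w t ω * G t ω) μ := fun t ht =>
    (integrable_of_map_eq_gaussianReal (run.measurable_exploration t)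
      (run.law_exploration t)).1.mul_bdd (hGm t).aestronglyMeasurable (hGB t ht)
  have hw2 := fun t => integral_sq_of_map_eq_gaussianReal (run.measurable_exploration t)
    (run.law_exploration t)
  have h1 : ∑ t ∈ Finset.range T, ∫ ω, c t ω * G t ω ∂μ ≤ 10 * Real.exp 23 * Q := by
    rw [← integral_finsetSum _ hci]
    -- The largest excess bounds all costs at once and leaves the sum, so the potential bound
    -- applies on each path before integration.
    have hpt : ∀ ω, ∑ t ∈ Finset.range T, c t ω * G t ω ≤
        Real.exp (9 / 10 * maxExcess H R X ε T ω) * (Real.exp 23 * Q) := fun ω => by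
      have hs := sum_g_le hK R hD (fun s => X s ω) hT
      calc _ ≤ ∑ t ∈ Finset.range T,
            Real.exp 23 * Real.exp (9 / 10 * maxExcess H R X ε T ω) * G t ω :=
          Finset.sum_le_sum fun t ht => mul_le_mul_of_nonneg_right (hcle t ht ω) (hG0 t ω)
        _ ≤ Real.exp 23 * Real.exp (9 / 10 * maxExcess H R X ε T ω) * Q := by
          rw [← Finset.mul_sum]
          exact mul_le_mul_of_nonneg_left hs (by positivity)
        _ = _ := by ring
    refine (integral_mono (integrable_finsetSum _ hci) (hEi.mul_const _) hpt).trans ?_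
    rw [integral_mul_const]
    have := mul_le_mul_of_nonneg_right hE (by positivity : 0 ≤ Real.exp 23 * Q)
    linarith
  -- The played arm depends on `w t`, so this term need not vanish; Cauchy–Schwarz and `E ∑ w_t² =
  -- T` bound it.
  have h2 : ∑ t ∈ Finset.range T, ∫ ω, w t ω * G t ω ∂μ ≤ Q := by
    rw [← integral_finsetSum _ hwi]
    have hi1 : Integrable (fun ω => ∑ t ∈ Finset.range T, w t ω ^ 2) μ :=
      integrable_finsetSum _ fun t _ => (hw2 t).1
    have hi2 : Integrable (fun ω => ((∑ t ∈ Finset.range T, w t ω ^ 2) / T + 1) / 2 * Q) μ :=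
      (((hi1.div_const _).add (integrable_const 1)).div_const 2).mul_const Q
    refine (integral_mono (integrable_finsetSum _ hwi) hi2 fun ω =>
      sum_mul_g_le hK R hD (fun s => X s ω) hT fun t => w t ω).trans (le_of_eq ?_)
    have hT' : (T : ℝ) ≠ 0 := Nat.cast_ne_zero.2 hT.ne'
    rw [integral_mul_const, integral_div, integral_add (hi1.div_const _) (integrable_const _),
      integral_div, integral_finsetSum _ fun t _ => (hw2 t).1]
    simp [(hw2 _).2, hT']
  rw [regret]
  refine (Finset.sum_le_sum fun t _ =>
    sub_integral_le_of_run hKm hK hR hf run xs t).trans ?_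
  rw [Finset.sum_add_distrib]
  linarith

theorem regret_le_of_small_kernel (hKm : Measurable fun p : A × A => K H p.1 p.2)
    (hK : ∀ z : A, K H z z ≤ 1) (hf : ‖f‖ ≤ D) (hX : ∀ t, Measurable (X t)) (xs : A) (T : ℕ)
    {k : ℝ} (hk : ∀ z : A, K H z z ≤ k) : regret μ f xs X T ≤ T * (2 * (D * √k)) := by
  have hD : 0 ≤ D := (norm_nonneg f).trans hf
  have hz : ∀ z, |f z| ≤ D * √k := fun z =>
    (abs_coe_le f hf z).trans (mul_le_mul_of_nonneg_left (Real.sqrt_le_sqrt (hk z)) hD)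
  have h : ∀ t ∈ Finset.range T, f xs - ∫ ω, f (X t ω) ∂μ ≤ 2 * (D * √k) := fun t _ => by
    have h1 := (abs_le.1 (hz xs)).2
    have h2 : ∫ _, -(D * √k) ∂μ ≤ ∫ ω, f (X t ω) ∂μ :=
      integral_mono (integrable_const _) (integrable_coe_comp hKm hK f (hX t))
        fun ω => (abs_le.1 (hz _)).1
    rw [integral_const, probReal_univ, one_smul] at h2
    linarith
  refine (Finset.sum_le_card_nsmul _ _ _ h).trans (le_of_eq ?_)
  rw [Finset.card_range, nsmul_eq_mul]

theorem regret_le [StandardBorelSpace A] (hKm : Measurable fun p : A × A => K H p.1 p.2)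
    (hK : ∀ z : A, K H z z ≤ 1) (hR : 0 ≤ R) (hf : ‖f‖ ≤ D)
    (run : IsSimpleGaussianRun H μ R D f X ε w) (xs : A) {T : ℕ} (hT : 2 ≤ T) :
    regret μ f xs X T ≤ 12 * (10 * Real.exp 23 + 1) *
      (√(T * Real.log T * infoGain H T) * (√(R ^ 2 * infoGain H T) + D)) := by
  have hD : 0 ≤ D := (norm_nonneg f).trans hf
  have hT0 : 0 < T := by omega
  have hT' : (2 : ℝ) ≤ T := by exact_mod_cast hT
  have h0 := infoGain_nonneg H T
  set γ := infoGain H T with hγ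
  have hlog : (1 / 4 : ℝ) ≤ Real.log T := by
    have := Real.log_le_log two_pos hT'
    have := Real.log_two_gt_d9
    linarith
  have hs : √T * √γ ≤ 2 * √(T * Real.log T * γ) := by
    have h4 : (2 : ℝ) = √4 := by
      rw [show (4 : ℝ) = 2 ^ 2 by norm_num, Real.sqrt_sq (by norm_num)]
    rw [← Real.sqrt_mul (by positivity), h4, ← Real.sqrt_mul (by norm_num)]
    refine Real.sqrt_le_sqrt ?_
    have : 0 ≤ (T : ℝ) * γ := by positivity
    nlinarith
  set S := √(T * Real.log T * γ)
  have hS0 : 0 ≤ S := Real.sqrt_nonneg _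
  have hN0 : 0 ≤ √(R ^ 2 * γ) := Real.sqrt_nonneg _
  have he := Real.exp_pos 23
  -- The term `log 2` in `explorationBound` is absorbed by `γ` only if `γ` is bounded below.
  -- Otherwise `|f| ≤ D √(4γ/T)`, and the regret is at most `4D √(Tγ)` whatever is played.
  rcases le_total γ (1 / 2) with hsmall | hlarge
  · have h1 := regret_le_of_small_kernel (μ := μ) hKm hK hf run.measurable_arm xs T
      (kernel_le_of_infoGain_le hK hT0 hsmall)
    have h2 : (T : ℝ) * √(4 * γ / T) = 2 * (√T * √γ) := by
      have h4 : √4 = 2 := by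
        rw [show (4 : ℝ) = 2 ^ 2 by norm_num, Real.sqrt_sq (by norm_num)]
      have h5 : √(T : ℝ) ≠ 0 := (Real.sqrt_pos.2 (by linarith)).ne'
      rw [Real.sqrt_div (by positivity), Real.sqrt_mul (by norm_num), h4]
      field_simp
      rw [Real.sq_sqrt (by linarith), mul_comm]
    have h3 : regret μ f xs X T ≤ 4 * D * (√T * √γ) := by
      refine h1.trans (le_of_eq ?_)
      linear_combination (2 * D) * h2
    have h4 := mul_le_mul_of_nonneg_left hs (by positivity : 0 ≤ 4 * D)
    have h5 : 0 ≤ S * √(R ^ 2 * γ) := by positivity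
    have h6 : 0 ≤ S * D := by positivity
    nlinarith
  · have h1 := regret_le_of_run hKm hK hR hf run xs hT0
    have h2 : explorationBound H R D T ≤ 3 * (√(R ^ 2 * γ) + D) := by
      have : √(2 * R ^ 2 * (Real.log 2 + γ)) ≤ 3 * √(R ^ 2 * γ) := by
        have h9 : (3 : ℝ) = √9 := by
          rw [show (9 : ℝ) = 3 ^ 2 by norm_num, Real.sqrt_sq (by norm_num)]
        rw [h9, ← Real.sqrt_mul (by norm_num)]
        refine Real.sqrt_le_sqrt ?_
        have := Real.log_two_lt_d9
        nlinarith [sq_nonneg R]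
      rw [explorationBound]
      linarith
    refine h1.trans ?_
    have h3 : 2 * √T * explorationBound H R D T * √γ ≤ 12 * (S * (√(R ^ 2 * γ) + D)) := by
      calc _ = 2 * (√T * √γ) * explorationBound H R D T := by ring
        _ ≤ 2 * (2 * S) * (3 * (√(R ^ 2 * γ) + D)) := by
          refine mul_le_mul (by linarith) h2 (explorationBound_nonneg R hD T) (by positivity)
        _ = _ := by ring
    have := mul_le_mul_of_nonneg_left h3 (by positivity : 0 ≤ 10 * Real.exp 23 + 1)
    linarith

end Regret

end KernelBandit

end

theorem mainTheorem7 :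
    ∃ C : ℝ, 0 < C ∧
      ∀ (d : ℕ) (𝒳 : Set (EuclideanSpace ℝ (Fin d))), IsCompact 𝒳 →
      ∀ (H : Type*) [NormedAddCommGroup H] [InnerProductSpace ℝ H] [CompleteSpace H]
        [RKHS ℝ H 𝒳 ℝ],
        Measurable (fun p : 𝒳 × 𝒳 => KernelBandit.K H p.1 p.2) →
        (∀ x : 𝒳, KernelBandit.K H x x ≤ 1) →
      ∀ (R D : ℝ), 0 ≤ R →
      ∀ (f : H), ‖f‖ ≤ D →
      ∀ (xStar : 𝒳), (∀ x : 𝒳, f x ≤ f xStar) →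
      ∀ (Ω : Type*) [MeasurableSpace Ω] (μ : Measure Ω) [IsProbabilityMeasure μ]
        (X : ℕ → Ω → 𝒳) (ε w : ℕ → Ω → ℝ),
        KernelBandit.IsSimpleGaussianRun H μ R D f X ε w →
      ∀ T : ℕ, 2 ≤ T →
        KernelBandit.regret μ f xStar X T ≤
          C * (√(T * Real.log T * KernelBandit.infoGain H T) *
            (√(R ^ 2 * KernelBandit.infoGain H T) + D)) := by
  refine ⟨12 * (10 * Real.exp 23 + 1), by positivity, ?_⟩
  intro d 𝒳 h𝒳 H _ _ _ _ hKm hK R D hR f hf xStar _ Ω _ μ _ X ε w run T hT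
  -- Compactness makes the arm space standard Borel, which provides the conditional law of the
  -- played arm used for resampling.
  have : StandardBorelSpace 𝒳 := h𝒳.measurableSet.standardBorel
  exact KernelBandit.regret_le hKm hK hR hf run xStar hT
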